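/- **Theorem (Iteration complexity of Perturbed Smoothed GDA).** Consider $\min_{x\in\mathcal X}\max_{y\in\mathcal Y} f(x,y)$, where $\mathcal X\subseteq\mathbb R^n$ is closed and convex, $\mathcal Y\subseteq\mathbb R^d$ is compact and convex with $0\in\mathcal Y$ and diameter $D_{\mathcal Y}>0$, and $f:\mathbb R^n\times\mathbb R^d\to\mathbb R$ is continuously differentiable, concave in $y$ on $\mathcal Y$ for each $x\in\mathcal X$, and $\ell$-smooth with $\ell>0$: for all $x,x'\in\mathcal X$, $y,y'\in\mathcal Y$, $$\|\nabla_x f(x,y)-\nabla_x f(x',y')\|\le \ell(\|x-x'\|+\|y-y'\|),\qquad \|\nabla_y f(x,y)-\nabla_y f(x',y')\|\le \ell(\|x-x'\|+\|y-y'\|).$$ Assume $\inf_{x\in\mathcal X}\max_{y\in\mathcal Y}f(x,y)>-\infty$. *Stationarity.* Let $\iota_K$ be the indicator function of a set $K$ ($0$ on $K$, $+\infty$ elsewhere) and $\Phi(x)=\max_{y\in\mathcal Y}f(x,y)+\iota_{\mathcal X}(x)$. A point $x\in\mathcal X$ is an $\epsilon$-optimization-stationary point if $\|\mathrm{prox}_{\frac1{2\ell}\Phi}(x)-x\|\le\frac{\epsilon}{2\ell}$,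 where $\mathrm{prox}_{\frac1{2\ell}\Phi}(x)=\arg\min_u\{\Phi(u)+\ell\|u-x\|^2\}$. A pair $(x,y)\in\mathcal X\times\mathcal Y$ is an $\epsilon$-game-stationary point if $\mathrm{dist}(0,\nabla_xf(x,y)+\partial\iota_{\mathcal X}(x))\le\epsilon$ and $\mathrm{dist}(0,-\nabla_yf(x,y)+\partial\iota_{\mathcal Y}(y))\le\epsilon$. *Algorithm.* Let $\widetilde f(x,y)=f(x,y)-\frac{r_y}2\|y\|^2$ and $\widetilde F(x,y,z)=\widetilde f(x,y)+\frac{r_x}{2}\|x-z\|^2$. From $x_0\in\mathcal X$, $y_0\in\mathcal Y$, $z_0\in\mathbb R^n$, Perturbed Smoothed GDA iterates $$x_{t+1}=\mathrm{proj}_{\mathcal X}(x_t-c\nabla_x\widetilde F(x_t,y_t,z_t)),\quad y_{t+1}=\mathrm{proj}_{\mathcal Y}(y_t+\alpha\nabla_y\widetilde F(x_{t+1},y_t,z_t)),\quad z_{t+1}=z_t+\beta(x_{t+1}-z_t).$$ Its initial gap is $\Delta_{\Psi_2}=\Psi_2(x_0,y_0,z_0)-\inf_{x\in\mathcal X}\max_{y\in\mathcal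 Y}\widetilde f(x,y)$, where $$\Psi_2(x,y,z)=\widetilde F(x,y,z)-2\min_{x'\in\mathcal X}\widetilde F(x',y,z)+2\min_{x'\in\mathcal X}\max_{y'\in\mathcal Y}\widetilde F(x',y',z).$$ *Parameters.* For $0<m\le M$, write $u=\Theta_{m,M}(v)$ for $mv\le u\le Mv$. Fix $m,M$. The parameters satisfy $0<r_y\le\ell$ and - $r_x=\Theta_{m,M}(\ell)$ and $r_x>3\ell$; - $\alpha=\Theta_{m,M}(1/\ell)$ and $0<\alpha\le\min\left\{\frac1{11\ell},\frac{c^2(r_x-\ell)^2}{4\ell(1+c(r_x-\ell))^2}\right\}$; - $c=\Theta_{m,M}(1/\ell)$ and $0<c<\frac1{r_x+\ell}$; - $\beta=\Theta_{m,M}(r_y/\ell)$ and $0<\beta\le\min\left\{\frac1{36},\frac{(r_x-\ell)^2}{384r_x(r_x+\ell)^2},\frac1{384r_x\alpha\omega^2}\right\}$, where $\omega=\frac1{\sqrt{2r_y}}\cdot\frac{(r_x-\ell)+\alpha\ell(3r_x-2\ell)}{\alpha(r_x-\ell)^{3/2}}$. Then the following hold for every $\epsilon>0$. (i) (Game stationarity)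 For every $\kappa<1$ there is a constant $C>0$, depending only on $m,M,\kappa$, such that if $m\frac{\epsilon}{D_{\mathcal Y}}\le r_y\le\kappa\frac{\epsilon}{D_{\mathcal Y}}$, then there is an index $t\ge 0$ with $$t\le C\,\frac{\ell^2D_{\mathcal Y}\Delta_{\Psi_2}}{\epsilon^3}$$ such that $(x_{t+1},y_{t+1})$ is an $\epsilon$-game-stationary point. (ii) (Optimization stationarity) For every $\kappa<\frac14$ there is a constant $C>0$, depending only on $m,M,\kappa$, such that if $m\frac{\epsilon^2}{\ell D_{\mathcal Y}^2}\le r_y\le\kappa\frac{\epsilon^2}{\ell D_{\mathcal Y}^2}$, then there is an index $t\ge0$ with $$t\le C\,\frac{\ell^3D_{\mathcal Y}^2\Delta_{\Psi_2}}{\epsilon^4}$$ such that $x_{t+1}$ is an $\epsilon$-optimization-stationary point. -/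

import Mathlib

/-- `ℝⁿ` with its Euclidean norm. -/
abbrev RVec (n : ℕ) : Type := EuclideanSpace ℝ (Fin n)

/-- `u = Θ(v)` with lower constant `m` and upper constant `M`. -/
def IsThetaWith (m M u v : ℝ) : Prop := m * v ≤ u ∧ u ≤ M * v

/-- `p` is a Euclidean projection of `u` onto `K`, i.e. a nearest point of `K`
(it exists and is unique when `K` is nonempty, closed and convex). -/
def IsProjOnto {n : ℕ} (K : Set (RVec n)) (u p : RVec n) : Prop :=
  p ∈ K ∧ ∀ w ∈ K, ‖p - u‖ ≤ ‖w - u‖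

/-- The subdifferential `∂ι_K(u)` of the indicator function of `K`: all `v` with
`ι_K(w) ≥ ι_K(u) + ⟪v, w - u⟫` for every `w`; it is empty when `u ∉ K`. -/
def indicatorSubdiff {n : ℕ} (K : Set (RVec n)) (u : RVec n) : Set (RVec n) :=
  {v | u ∈ K ∧ ∀ w ∈ K, inner ℝ v (w - u) ≤ 0}

/-- The partial gradient `∇ₓ f(x, y)`. -/
noncomputable def gradX {n d : ℕ} (f : RVec n → RVec d → ℝ) (x : RVec n) (y : RVec d) : RVec n :=
  gradient (fun x' => f x' y) x

/-- The partial gradient `∇_y f(x, y)`. -/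
noncomputable def gradY {n d : ℕ} (f : RVec n → RVec d → ℝ) (x : RVec n) (y : RVec d) : RVec d :=
  gradient (fun y' => f x y') y

/-- The primal value function `max_{y ∈ Y} f(x, y)`. -/
noncomputable def primalValue {n d : ℕ} (Y : Set (RVec d)) (f : RVec n → RVec d → ℝ)
    (x : RVec n) : ℝ :=
  ⨆ y : Y, f x y

/-- `ℓ`-smoothness: `f` is continuously differentiable and both partial gradients satisfy the
Lipschitz estimate with constant `ℓ > 0` on `X × Y`. -/
structure IsSmoothOn {n d : ℕ} (X : Set (RVec n)) (Y : Set (RVec d))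
    (f : RVec n → RVec d → ℝ) (ℓ : ℝ) : Prop where
  pos : 0 < ℓ
  contDiff : ContDiff ℝ 1 (fun p : RVec n × RVec d => f p.1 p.2)
  lipX : ∀ x ∈ X, ∀ x' ∈ X, ∀ y ∈ Y, ∀ y' ∈ Y,
    ‖gradX f x y - gradX f x' y'‖ ≤ ℓ * (‖x - x'‖ + ‖y - y'‖)
  lipY : ∀ x ∈ X, ∀ x' ∈ X, ∀ y ∈ Y, ∀ y' ∈ Y,
    ‖gradY f x y - gradY f x' y'‖ ≤ ℓ * (‖x - x'‖ + ‖y - y'‖)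

/-- The standing assumptions on `min_{x ∈ X} max_{y ∈ Y} f(x, y)`, the diameter of the dual domain
being `Metric.diam Y`. The last field says that the value of the problem is not `-∞`. -/
structure IsNCCProblem {n d : ℕ} (X : Set (RVec n)) (Y : Set (RVec d))
    (f : RVec n → RVec d → ℝ) (ℓ : ℝ) : Prop where
  closed_X : IsClosed X
  convex_X : Convex ℝ X
  compact_Y : IsCompact Y
  convex_Y : Convex ℝ Y
  zero_mem_Y : (0 : RVec d) ∈ Y
  diam_pos : 0 < Metric.diam Y
  smooth : IsSmoothOn X Y f ℓ
  concave : ∀ x ∈ X, ConcaveOn ℝ Y (f x)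
  bddBelow : BddBelow (primalValue Y f '' X)

/-- `(x, y)` is an `ε`-game-stationary point. -/
def IsGameStationary {n d : ℕ} (X : Set (RVec n)) (Y : Set (RVec d))
    (f : RVec n → RVec d → ℝ) (ε : ℝ) (x : RVec n) (y : RVec d) : Prop :=
  x ∈ X ∧ y ∈ Y ∧
  Metric.infDist 0 ((fun v => gradX f x y + v) '' indicatorSubdiff X x) ≤ ε ∧
  Metric.infDist 0 ((fun v => -gradY f x y + v) '' indicatorSubdiff Y y) ≤ ε

/-- `p = prox_{sΦ}(x)`, where `Φ` is the primal value function plus the indicator function of `X`: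
`p` minimizes `Φ(u) + ‖u - x‖² / (2s)`. -/
def IsProx {n d : ℕ} (X : Set (RVec n)) (Y : Set (RVec d))
    (f : RVec n → RVec d → ℝ) (s : ℝ) (x p : RVec n) : Prop :=
  p ∈ X ∧ IsMinOn (fun u => primalValue Y f u + 1 / (2 * s) * ‖u - x‖ ^ 2) X p

/-- `x` is an `ε`-optimization-stationary point:
`‖prox_{Φ/(2ℓ)}(x) - x‖ ≤ ε / (2ℓ)`. -/
def IsOptStationary {n d : ℕ} (X : Set (RVec n)) (Y : Set (RVec d))
    (f : RVec n → RVec d → ℝ) (ℓ ε : ℝ) (x : RVec n) : Prop :=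
  x ∈ X ∧ ∃ p, IsProx X Y f (1 / (2 * ℓ)) x p ∧ ‖p - x‖ ≤ ε / (2 * ℓ)

/-- The perturbed objective `f(x, y) - (r_y / 2) ‖y‖²`. -/
noncomputable def pertObj {n d : ℕ} (f : RVec n → RVec d → ℝ) (ry : ℝ)
    (x : RVec n) (y : RVec d) : ℝ :=
  f x y - ry / 2 * ‖y‖ ^ 2

/-- The surrogate `F(x, y, z) = f(x, y) + (r_x / 2) ‖x - z‖² - (r_y / 2) ‖y‖²`
(the argument `z` comes first). -/
noncomputable def surrogate {n d : ℕ} (f : RVec n → RVec d → ℝ) (rx ry : ℝ) (z : RVec n)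
    (x : RVec n) (y : RVec d) : ℝ :=
  f x y + rx / 2 * ‖x - z‖ ^ 2 - ry / 2 * ‖y‖ ^ 2

/-- The potential `Ψ₂(x, y, z)`. -/
noncomputable def potential {n d : ℕ} (X : Set (RVec n)) (Y : Set (RVec d))
    (f : RVec n → RVec d → ℝ) (rx ry : ℝ) (x : RVec n) (y : RVec d) (z : RVec n) : ℝ :=
  surrogate f rx ry z x y - 2 * (⨅ u : X, surrogate f rx ry z u y)
    + 2 * (⨅ u : X, ⨆ v : Y, surrogate f rx ry z u v)

/-- The initial gap `Δ = Ψ₂(x₀, y₀, z₀) - min_{x ∈ X} max_{y ∈ Y} (f(x, y) - (r_y / 2) ‖y‖²)`. -/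
noncomputable def initialGap {n d : ℕ} (X : Set (RVec n)) (Y : Set (RVec d))
    (f : RVec n → RVec d → ℝ) (rx ry : ℝ) (x₀ : RVec n) (y₀ : RVec d) (z₀ : RVec n) : ℝ :=
  potential X Y f rx ry x₀ y₀ z₀ - ⨅ u : X, ⨆ v : Y, pertObj f ry u v

/-- The sequence `(x_t, y_t, z_t)` is generated by Perturbed Smoothed GDA with smoothing parameter
`rx`, perturbation parameter `ry` and step sizes `c`, `α`, `β`. -/
structure IsPerturbedSmoothedGDA {n d : ℕ} (X : Set (RVec n)) (Y : Set (RVec d))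
    (f : RVec n → RVec d → ℝ) (rx ry c α β : ℝ)
    (x : ℕ → RVec n) (y : ℕ → RVec d) (z : ℕ → RVec n) : Prop where
  init_x : x 0 ∈ X
  init_y : y 0 ∈ Y
  step_x : ∀ t, IsProjOnto X (x t - c • gradX (surrogate f rx ry (z t)) (x t) (y t)) (x (t + 1))
  step_y : ∀ t,
    IsProjOnto Y (y t + α • gradY (surrogate f rx ry (z t)) (x (t + 1)) (y t)) (y (t + 1))
  step_z : ∀ t, z (t + 1) = z t + β • (x (t + 1) - z t)

/-- The constant `ω` in the step-size condition. -/
noncomputable def omegaConst (ℓ rx ry α : ℝ) : ℝ :=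
  1 / √(2 * ry) *
    (((rx - ℓ) + α * ℓ * (3 * rx - 2 * ℓ)) / (α * (rx - ℓ) ^ (3 / 2 : ℝ)))

/-- The step-size condition for Perturbed Smoothed GDA, where every `Θ(·)` in it
has the constants `m` and `M`. -/
structure StepSizeCondition (m M ℓ rx ry c α β : ℝ) : Prop where
  ry_pos : 0 < ry
  rx_theta : IsThetaWith m M rx ℓ
  rx_gt : 3 * ℓ < rx
  α_theta : IsThetaWith m M α (1 / ℓ)
  α_pos : 0 < α
  α_le : α ≤ min (1 / (11 * ℓ))
    (c ^ 2 * (rx - ℓ) ^ 2 / (4 * ℓ * (1 + c * (rx - ℓ)) ^ 2))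
  c_theta : IsThetaWith m M c (1 / ℓ)
  c_pos : 0 < c
  c_lt : c < 1 / (rx + ℓ)
  β_pos : 0 < β
  β_le : β ≤ min (1 / 36) ((rx - ℓ) ^ 2 / (384 * rx * (rx + ℓ) ^ 2))
  β_theta : IsThetaWith m M β (ry / ℓ)
  β_le_omega : β ≤ 1 / (384 * rx * α * omegaConst ℓ rx ry α ^ 2)

/-!
Along one step the potential `Ψ₂` drops by at least `ℓ (‖x⁺ - x‖² + ‖y⁺ - y‖² + β ‖x⁺ - z‖²)`. The
descent step in `x`, the ascent step in `y` (through Danskin's theorem for the function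
`y ↦ min_u F(u, y, z)`) and the averaging step in `z` all decrease it; the only adverse term is the
distance of the saddle point of `F(·, ·, z)` from the minimizer of the shifted surrogate. Since the
perturbation makes `F` strongly concave in `y` with modulus `r_y`, the length of a projected ascent
step controls this distance up to the factor `ω` (the dual error bound), and `β ω²` is small enough
for the other terms to absorb it.

As `Ψ₂` is bounded below by the perturbed minimax value, some early step is short. The optimality
conditions of the two projections turn a short step into small residuals of the unperturbed problem,
at the additional cost `r_y ‖y‖ ≤ r_y D` in the dual one; this is game stationarity. For
optimization stationarity, the proximal point is the primal part of a saddle point of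
`f + ℓ ‖· - x‖²`, and the variational inequalities at `(x, y)` together with strong convexity
bound its distance to `x`.
-/

open Filter Topology Set
open scoped InnerProductSpace

section QuadraticBounds

variable {E : Type*} [NormedAddCommGroup E] [InnerProductSpace ℝ E]

/-- At every point of `K`, the function `h` lies on `K` between the two quadratic models with
linear part `g` and curvatures `μ` and `L`. For `g = ∇h` on a convex set this is `μ`-strong
convexity together with `L`-smoothness; the curvatures may be negative, so that concave functions
are covered by `L ≤ 0`. -/
structure HasQuadraticBoundsOn (h : E → ℝ) (g : E → E) (μ L : ℝ) (K : Set E) : Prop where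
  lower : ∀ ⦃x⦄, x ∈ K → ∀ ⦃u⦄, u ∈ K → h x + ⟪g x, u - x⟫_ℝ + μ / 2 * ‖u - x‖ ^ 2 ≤ h u
  upper : ∀ ⦃x⦄, x ∈ K → ∀ ⦃u⦄, u ∈ K → h u ≤ h x + ⟪g x, u - x⟫_ℝ + L / 2 * ‖u - x‖ ^ 2

lemma norm_sub_sq_eq_add_inner (u x z : E) :
    ‖u - z‖ ^ 2 = ‖x - z‖ ^ 2 + 2 * ⟪x - z, u - x⟫_ℝ + ‖u - x‖ ^ 2 := by
  rw [← norm_add_sq_real, sub_add_sub_cancel']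

lemma nonpos_of_forall_mul_le_mul_sq {a b : ℝ}
    (h : ∀ s : ℝ, 0 < s → s ≤ 1 → a * s ≤ b * s ^ 2) : a ≤ 0 := by
  have hle : ∀ᶠ s : ℝ in 𝓝[>] 0, a ≤ b * s := by
    filter_upwards [Ioc_mem_nhdsGT (zero_lt_one (α := ℝ))] with s hs
    refine le_of_mul_le_mul_right ?_ hs.1
    linarith [h s hs.1 hs.2]
  have hlim : Tendsto (fun s : ℝ => b * s) (𝓝[>] 0) (𝓝 0) := by
    simpa using ((continuous_const_mul b).tendsto 0).mono_left nhdsWithin_le_nhds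
  exact ge_of_tendsto hlim hle

namespace HasQuadraticBoundsOn

variable {h h' : E → ℝ} {g g' : E → E} {μ μ' L L' : ℝ} {K : Set E} {p p' u : E}

lemma neg (H : HasQuadraticBoundsOn h g μ L K) :
    HasQuadraticBoundsOn (fun x => -h x) (fun x => -g x) (-L) (-μ) K where
  lower x hx u hu := by
    rw [inner_neg_left]
    linarith [H.upper hx hu]
  upper x hx u hu := by
    rw [inner_neg_left]
    linarith [H.lower hx hu]

lemma add_sq_norm_sub (H : HasQuadraticBoundsOn h g μ L K) (r : ℝ) (z : E) :
    HasQuadraticBoundsOn (fun x => h x + r / 2 * ‖x - z‖ ^ 2) (fun x => g x + r • (x - z))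
      (μ + r) (L + r) K where
  lower x hx u hu := by
    rw [inner_add_left, real_inner_smul_left, norm_sub_sq_eq_add_inner u x z]
    linarith [H.lower hx hu]
  upper x hx u hu := by
    rw [inner_add_left, real_inner_smul_left, norm_sub_sq_eq_add_inner u x z]
    linarith [H.upper hx hu]

lemma continuousOn (H : HasQuadraticBoundsOn h g μ L K) : ContinuousOn h K := by
  intro x hx
  have model_tendsto (κ : ℝ) :
      Tendsto (fun u => h x + ⟪g x, u - x⟫_ℝ + κ / 2 * ‖u - x‖ ^ 2) (𝓝[K] x) (𝓝 (h x)) := by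
    have hcont : Continuous fun u => h x + ⟪g x, u - x⟫_ℝ + κ / 2 * ‖u - x‖ ^ 2 := by fun_prop
    simpa using (hcont.tendsto x).mono_left nhdsWithin_le_nhds
  exact tendsto_of_tendsto_of_tendsto_of_le_of_le' (model_tendsto μ) (model_tendsto L)
    (eventually_mem_nhdsWithin.mono fun _ hu => H.lower hx hu)
    (eventually_mem_nhdsWithin.mono fun _ hu => H.upper hx hu)

lemma inner_nonneg_of_isMinOn (H : HasQuadraticBoundsOn h g μ L K) (hK : Convex ℝ K)
    (hp : p ∈ K) (hmin : IsMinOn h K p) (hu : u ∈ K) : 0 ≤ ⟪g p, u - p⟫_ℝ := by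
  suffices -⟪g p, u - p⟫_ℝ ≤ 0 by linarith
  refine nonpos_of_forall_mul_le_mul_sq (b := L / 2 * ‖u - p‖ ^ 2) fun s hs₀ hs₁ => ?_
  have hmem : p + s • (u - p) ∈ K := hK.add_smul_sub_mem hp hu ⟨hs₀.le, hs₁⟩
  have hup := H.upper hp hmem
  have hle : h p ≤ h (p + s • (u - p)) := hmin hmem
  rw [add_sub_cancel_left, inner_smul_right, norm_smul, mul_pow, Real.norm_of_nonneg hs₀.le] at hup
  linarith

lemma inner_nonpos_of_isMaxOn (H : HasQuadraticBoundsOn h g μ L K) (hK : Convex ℝ K)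
    (hp : p ∈ K) (hmax : IsMaxOn h K p) (hu : u ∈ K) : ⟪g p, u - p⟫_ℝ ≤ 0 := by
  have hneg := H.neg.inner_nonneg_of_isMinOn hK hp hmax.neg hu
  rwa [inner_neg_left, Left.nonneg_neg_iff] at hneg

lemma add_sq_le_of_isMinOn (H : HasQuadraticBoundsOn h g μ L K) (hK : Convex ℝ K)
    (hp : p ∈ K) (hmin : IsMinOn h K p) (hu : u ∈ K) : h p + μ / 2 * ‖u - p‖ ^ 2 ≤ h u := by
  linarith [H.lower hp hu, H.inner_nonneg_of_isMinOn hK hp hmin hu]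

lemma mul_norm_sub_le_of_isMinOn (H : HasQuadraticBoundsOn h g μ L K)
    (H' : HasQuadraticBoundsOn h' g' μ' L' K) (hK : Convex ℝ K) (hp : p ∈ K) (hp' : p' ∈ K)
    (hmin : IsMinOn h K p) (hmin' : IsMinOn h' K p') : μ * ‖p - p'‖ ≤ ‖g p' - g' p'‖ := by
  have hgrowth := H.add_sq_le_of_isMinOn hK hp hmin hp'
  have hlower := H.lower hp' hp
  have hopt := H'.inner_nonneg_of_isMinOn hK hp' hmin' hp
  have hcs := real_inner_le_norm (g' p' - g p') (p - p')
  rw [inner_sub_left, norm_sub_rev (g' p')] at hcs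
  rw [norm_sub_rev p' p] at hgrowth
  rcases (norm_nonneg (p - p')).eq_or_lt with h₀ | hpos
  · simp [← h₀]
  · refine le_of_mul_le_mul_right ?_ hpos
    linarith

lemma exists_isMinOn [ProperSpace E] (H : HasQuadraticBoundsOn h g μ L K) (hμ : 0 < μ)
    (hK : IsClosed K) (hne : K.Nonempty) : ∃ p ∈ K, IsMinOn h K p := by
  obtain ⟨x, hx⟩ := hne
  refine H.continuousOn.exists_isMinOn' hK hx (eventually_inf_principal.2 ?_)
  filter_upwards [(isCompact_closedBall x (2 * ‖g x‖ / μ)).compl_mem_cocompact] with u hu huK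
  have hfar : 2 * ‖g x‖ < μ * ‖u - x‖ := by
    rw [mem_compl_iff, Metric.mem_closedBall, dist_eq_norm, not_le, div_lt_iff₀ hμ] at hu
    linarith
  have hcs := neg_le_of_abs_le (abs_real_inner_le_norm (g x) (u - x))
  nlinarith [H.lower hx huK, norm_nonneg (u - x)]

end HasQuadraticBoundsOn

section Gradient

variable [CompleteSpace E] {h : E → ℝ} {g : E → E} {L : ℝ} {K : Set E}

lemma hasDerivAt_comp_add_smul (hg : ∀ x, HasGradientAt h (g x) x) (x v : E) (s : ℝ) :
    HasDerivAt (fun s : ℝ => h (x + s • v)) ⟪g (x + s • v), v⟫_ℝ s := by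
  have hline : HasDerivAt (fun s : ℝ => x + s • v) v s := by
    simpa using ((hasDerivAt_id s).smul_const v).const_add x
  have hcomp := (hg (x + s • v)).hasFDerivAt.comp_hasDerivAt s hline
  rwa [InnerProductSpace.toDual_apply_apply] at hcomp

lemma le_add_inner_add_sq_of_lipschitz_gradient (hg : ∀ x, HasGradientAt h (g x) x)
    (hK : Convex ℝ K) (hL : ∀ x ∈ K, ∀ u ∈ K, ‖g x - g u‖ ≤ L * ‖x - u‖) {x u : E}
    (hx : x ∈ K) (hu : u ∈ K) : h u ≤ h x + ⟪g x, u - x⟫_ℝ + L / 2 * ‖u - x‖ ^ 2 := by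
  let v := u - x
  let excess : ℝ → ℝ := fun s => h (x + s • v) - s * ⟪g x, v⟫_ℝ - L / 2 * s ^ 2 * ‖v‖ ^ 2
  have hderiv (s : ℝ) :
      HasDerivAt excess (⟪g (x + s • v), v⟫_ℝ - ⟪g x, v⟫_ℝ - L * s * ‖v‖ ^ 2) s := by
    refine (((hasDerivAt_comp_add_smul hg x v s).sub
      ((hasDerivAt_id s).mul_const ⟪g x, v⟫_ℝ)).sub
      (((hasDerivAt_pow 2 s).const_mul (L / 2)).mul_const (‖v‖ ^ 2))).congr_deriv ?_
    push_cast
    ring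
  have hderiv_nonpos : ∀ s ∈ Ioo (0 : ℝ) 1, deriv excess s ≤ 0 := by
    intro s hs
    have hlip := hL _ (hK.add_smul_sub_mem hx hu ⟨hs.1.le, hs.2.le⟩) x hx
    rw [add_sub_cancel_left, norm_smul, Real.norm_of_nonneg hs.1.le] at hlip
    have hcs := real_inner_le_norm (g (x + s • v) - g x) v
    rw [(hderiv s).deriv, ← inner_sub_left]
    nlinarith [norm_nonneg v]
  have hanti : AntitoneOn excess (Icc 0 1) :=
    antitoneOn_of_deriv_nonpos (convex_Icc 0 1)
      (fun s _ => (hderiv s).continuousAt.continuousWithinAt)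
      (fun s _ => (hderiv s).differentiableAt.differentiableWithinAt)
      (by rwa [interior_Icc])
  have hends : excess 1 ≤ excess 0 :=
    hanti (left_mem_Icc.2 zero_le_one) (right_mem_Icc.2 zero_le_one) zero_le_one
  simp only [excess, v, one_smul, zero_smul, add_sub_cancel, add_zero] at hends
  linarith

lemma hasQuadraticBoundsOn_of_lipschitz_gradient (hg : ∀ x, HasGradientAt h (g x) x)
    (hK : Convex ℝ K) (hL : ∀ x ∈ K, ∀ u ∈ K, ‖g x - g u‖ ≤ L * ‖x - u‖) :
    HasQuadraticBoundsOn h g (-L) L K where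
  lower x hx u hu := by
    have hneg := le_add_inner_add_sq_of_lipschitz_gradient (h := fun x => -h x)
      (g := fun x => -g x) (fun x => by
        rw [hasGradientAt_iff_hasFDerivAt, map_neg]
        exact (hg x).hasFDerivAt.neg) hK
      (fun x hx u hu => by rw [neg_sub_neg, norm_sub_rev]; exact hL x hx u hu) hx hu
    rw [inner_neg_left] at hneg
    linarith
  upper _ hx _ hu := le_add_inner_add_sq_of_lipschitz_gradient hg hK hL hx hu

lemma le_add_inner_gradient_of_concaveOn (hc : ConcaveOn ℝ K h)
    (hg : ∀ x, HasGradientAt h (g x) x) {x u : E} (hx : x ∈ K) (hu : u ∈ K) :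
    h u ≤ h x + ⟪g x, u - x⟫_ℝ := by
  have hderiv := hasDerivAt_comp_add_smul hg x (u - x) 0
  simp only [zero_smul, add_zero] at hderiv
  have hslope : ∀ᶠ s : ℝ in 𝓝[>] 0,
      h u - h x ≤ s⁻¹ • (h (x + (0 + s) • (u - x)) - h (x + (0 : ℝ) • (u - x))) := by
    filter_upwards [Ioc_mem_nhdsGT (zero_lt_one (α := ℝ))] with s hs
    have hconc := hc.2 hx hu (sub_nonneg.2 hs.2) hs.1.le (sub_add_cancel 1 s)
    rw [show (1 - s) • x + s • u = x + s • (u - x) by module] at hconc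
    simp only [smul_eq_mul, zero_add, zero_smul, add_zero] at hconc ⊢
    rw [inv_mul_eq_div, le_div_iff₀ hs.1]
    linarith
  linarith [ge_of_tendsto hderiv.tendsto_slope_zero_right hslope]

lemma hasQuadraticBoundsOn_of_concaveOn (hg : ∀ x, HasGradientAt h (g x) x)
    (hc : ConcaveOn ℝ K h) (hL : ∀ x ∈ K, ∀ u ∈ K, ‖g x - g u‖ ≤ L * ‖x - u‖) :
    HasQuadraticBoundsOn h g (-L) 0 K where
  lower := (hasQuadraticBoundsOn_of_lipschitz_gradient hg hc.1 hL).lower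
  upper x hx u hu := by
    simpa using le_add_inner_gradient_of_concaveOn hc hg hx hu

end Gradient

end QuadraticBounds

section Projection

variable {n : ℕ} {K : Set (RVec n)}

namespace IsProjOnto

variable {u u' p p' w : RVec n}

lemma inner_nonpos (hp : IsProjOnto K u p) (hK : Convex ℝ K) (hw : w ∈ K) :
    ⟪u - p, w - p⟫_ℝ ≤ 0 := by
  refine (norm_eq_iInf_iff_real_inner_le_zero hK hp.1).1 ?_ w hw
  refine (IsMinOn.iInf_eq (f := fun w => ‖u - w‖) hp.1 fun w hw => ?_).symm
  simpa only [norm_sub_rev u, mem_ofPred_eq] using hp.2 w hw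

lemma norm_sub_le (hp : IsProjOnto K u p) (hp' : IsProjOnto K u' p') (hK : Convex ℝ K) :
    ‖p - p'‖ ≤ ‖u - u'‖ := by
  have hinner : ‖p - p'‖ ^ 2 ≤ ⟪u - u', p - p'⟫_ℝ := by
    have hvi := hp.inner_nonpos hK hp'.1
    have hvi' := hp'.inner_nonpos hK hp.1
    have hsplit : u - u' = (u - p) - (u' - p') + (p - p') := by abel
    rw [← neg_sub p p', inner_neg_right] at hvi
    rw [hsplit, inner_add_left, inner_sub_left, real_inner_self_eq_norm_sq]
    linarith
  have hcs := real_inner_le_norm (u - u') (p - p')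
  by_contra! hlt
  nlinarith [norm_nonneg (u - u')]

lemma smul_sub_mem_indicatorSubdiff (hp : IsProjOnto K u p) (hK : Convex ℝ K) {s : ℝ}
    (hs : 0 ≤ s) : s • (u - p) ∈ indicatorSubdiff K p := by
  refine ⟨hp.1, fun w hw => ?_⟩
  rw [real_inner_smul_left]
  exact mul_nonpos_of_nonneg_of_nonpos hs (hp.inner_nonpos hK hw)

end IsProjOnto

lemma exists_isProjOnto (hK : IsCompact K) (hne : K.Nonempty) (u : RVec n) :
    ∃ p, IsProjOnto K u p := by
  obtain ⟨p, hp, hmin⟩ := hK.exists_isMinOn hne (f := fun w => ‖w - u‖) (by fun_prop)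
  exact ⟨p, hp, fun _ hw => hmin hw⟩

lemma inner_add_inner_nonneg_of_step (hK : Convex ℝ K) {c : ℝ} {x p v w : RVec n}
    (hp : IsProjOnto K (x - c • v) p) (hw : w ∈ K) :
    0 ≤ c * ⟪v, w - p⟫_ℝ + ⟪p - x, w - p⟫_ℝ := by
  have hproj := hp.inner_nonpos hK hw
  rw [show x - c • v - p = -(c • v + (p - x)) by abel, inner_neg_left, inner_add_left,
    real_inner_smul_left] at hproj
  linarith

namespace HasQuadraticBoundsOn

variable {h : RVec n → ℝ} {g : RVec n → RVec n} {μ L c : ℝ} {x p q : RVec n}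

lemma add_sq_le_of_projected_step (H : HasQuadraticBoundsOn h g μ L K) (hK : Convex ℝ K)
    (hc : 0 < c) (hcL : c * L ≤ 1) (hx : x ∈ K) (hp : IsProjOnto K (x - c • g x) p) :
    h p + 1 / (2 * c) * ‖p - x‖ ^ 2 ≤ h x := by
  have hstep := inner_add_inner_nonneg_of_step hK hp hx
  have hup := H.upper hx hp.1
  rw [← neg_sub p x, inner_neg_right, inner_neg_right, real_inner_self_eq_norm_sq] at hstep
  have hdecr : c * h p + 1 / 2 * ‖p - x‖ ^ 2 ≤ c * h x := by
    nlinarith [sq_nonneg ‖p - x‖]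
  refine le_of_mul_le_mul_left ?_ hc
  calc c * (h p + 1 / (2 * c) * ‖p - x‖ ^ 2) = c * h p + 1 / 2 * ‖p - x‖ ^ 2 := by field_simp
    _ ≤ c * h x := hdecr

lemma mul_norm_sub_le_of_projected_step (H : HasQuadraticBoundsOn h g μ L K) (hK : Convex ℝ K)
    (hc : 0 < c) (hμL : μ ≤ L) (hcL : c * L ≤ 1) (hx : x ∈ K)
    (hp : IsProjOnto K (x - c • g x) p) (hq : q ∈ K) (hmin : IsMinOn h K q) :
    c * μ * ‖p - q‖ ≤ ‖p - x‖ := by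
  have hcμ : c * μ ≤ 1 := (mul_le_mul_of_nonneg_left hμL hc.le).trans hcL
  have hquad : c * μ * ‖p - q‖ ^ 2 ≤ (1 - c * μ) * (‖p - x‖ * ‖p - q‖ + ‖p - x‖ ^ 2 / 2) := by
    have hlower := H.lower hx hq
    have hupper := H.upper hx hp.1
    have hgrowth := H.add_sq_le_of_isMinOn hK hq hmin hp.1
    have hstep := inner_add_inner_nonneg_of_step hK hp hq
    have hcs := real_inner_le_norm (p - x) (q - p)
    rw [norm_sub_sq_eq_add_inner q p x, ← sub_add_sub_cancel q p x, inner_add_right] at hlower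
    rw [norm_sub_rev q p] at hlower hcs
    have hgap : c * (⟪g x, q - p⟫_ℝ + μ * ‖p - q‖ ^ 2 + μ * ⟪p - x, q - p⟫_ℝ
        + (μ - L) / 2 * ‖p - x‖ ^ 2) ≤ 0 :=
      mul_nonpos_of_nonneg_of_nonpos hc.le (by linarith)
    nlinarith [mul_le_mul_of_nonneg_left hcs (sub_nonneg.2 hcμ), sq_nonneg ‖p - x‖]
  by_contra! hlt
  have hprod := (norm_nonneg (p - x)).trans_lt hlt
  have hcμ_pos := pos_of_mul_pos_left hprod (norm_nonneg (p - q))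
  have hpq_pos := pos_of_mul_pos_right hprod hcμ_pos.le
  linarith [mul_lt_mul_of_pos_right hlt hpq_pos, sq_nonneg ‖p - x‖,
    mul_le_mul_of_nonneg_right hlt.le (norm_nonneg (p - x)),
    mul_nonneg hcμ_pos.le (sq_nonneg ‖p - x‖)]

end HasQuadraticBoundsOn

end Projection

lemma exists_le_of_forall_le_sub {Ψ s : ℕ → ℝ} {B δ : ℝ} (hδ : 0 < δ) (hB : ∀ t, B ≤ Ψ t)
    (hs : ∀ t, s t ≤ Ψ t - Ψ (t + 1)) : ∃ t : ℕ, (t : ℝ) ≤ (Ψ 0 - B) / δ ∧ s t ≤ δ := by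
  by_contra! hlarge
  have hgap : 0 ≤ (Ψ 0 - B) / δ := div_nonneg (sub_nonneg.2 (hB 0)) hδ.le
  set T := ⌊(Ψ 0 - B) / δ⌋₊ with hT
  have hsum : (T + 1) * δ ≤ Ψ 0 - Ψ (T + 1) := by
    have hcard := Finset.card_nsmul_le_sum (Finset.range (T + 1)) (fun t => Ψ t - Ψ (t + 1)) δ
    rw [Finset.sum_range_sub', Finset.card_range, nsmul_eq_mul, Nat.cast_add_one] at hcard
    refine hcard fun t ht => ?_
    have htT : (t : ℝ) ≤ (Ψ 0 - B) / δ :=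
      (Nat.le_floor_iff hgap).1 (Nat.lt_succ_iff.1 (Finset.mem_range.1 ht))
    exact (hlarge t htT).le.trans (hs t)
  have hfloor := Nat.lt_floor_add_one ((Ψ 0 - B) / δ)
  rw [← hT, div_lt_iff₀ hδ] at hfloor
  linarith [hB (T + 1)]

section SaddlePoint

section Value

variable {E G : Type*} {X : Set E} {Y : Set G} {F : E → G → ℝ} {a : E} {b : G}

lemma iSup_eq_of_isSaddlePointOn (hs : IsSaddlePointOn X Y F a b) (ha : a ∈ X) (hb : b ∈ Y) :
    ⨆ v : Y, F a v = F a b :=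
  IsMaxOn.iSup_eq hb fun v hv => hs a ha v hv

lemma isMinOn_iSup_of_isSaddlePointOn (hs : IsSaddlePointOn X Y F a b) (ha : a ∈ X) (hb : b ∈ Y)
    (hbdd : ∀ u ∈ X, BddAbove (F u '' Y)) : IsMinOn (fun u => ⨆ v : Y, F u v) X a := by
  intro u hu
  have hbdd_u := hbdd u hu
  rw [image_eq_range] at hbdd_u
  calc ⨆ v : Y, F a v = F a b := iSup_eq_of_isSaddlePointOn hs ha hb
    _ ≤ F u b := hs u hu b hb
    _ ≤ ⨆ v : Y, F u v := le_ciSup hbdd_u ⟨b, hb⟩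

lemma iInf_iSup_eq_of_isSaddlePointOn (hs : IsSaddlePointOn X Y F a b) (ha : a ∈ X) (hb : b ∈ Y)
    (hbdd : ∀ u ∈ X, BddAbove (F u '' Y)) : ⨅ u : X, ⨆ v : Y, F u v = F a b := by
  rw [(isMinOn_iSup_of_isSaddlePointOn hs ha hb hbdd).iInf_eq ha,
    iSup_eq_of_isSaddlePointOn hs ha hb]

end Value

variable {E G : Type*} [NormedAddCommGroup E] [InnerProductSpace ℝ E]
  [NormedAddCommGroup G] [InnerProductSpace ℝ G]

/-- Quantitative convexity, concavity and smoothness of a saddle function `F` with partial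
gradients `gx` and `gy` on `X × Y`: the sections `F (·, y)` have curvatures between `μ` and `L`,
the sections `F (x, ·)` have curvatures between `-K` and `-ν`, and `ℓ` bounds the variation of each
partial gradient with respect to the other variable. -/
structure HasSaddleBoundsOn (X : Set E) (Y : Set G) (F : E → G → ℝ) (gx : E → G → E)
    (gy : E → G → G) (μ L ν K ℓ : ℝ) : Prop where
  left : ∀ ⦃y⦄, y ∈ Y → HasQuadraticBoundsOn (fun x => F x y) (fun x => gx x y) μ L X
  right : ∀ ⦃x⦄, x ∈ X → HasQuadraticBoundsOn (F x) (gy x) (-K) (-ν) Y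
  norm_gx_sub_le : ∀ ⦃x⦄, x ∈ X → ∀ ⦃y⦄, y ∈ Y → ∀ ⦃y'⦄, y' ∈ Y →
    ‖gx x y - gx x y'‖ ≤ ℓ * ‖y - y'‖
  norm_gy_sub_le : ∀ ⦃x⦄, x ∈ X → ∀ ⦃x'⦄, x' ∈ X → ∀ ⦃y⦄, y ∈ Y → ∀ ⦃y'⦄, y' ∈ Y →
    ‖gy x y - gy x' y'‖ ≤ ℓ * ‖x - x'‖ + K * ‖y - y'‖

namespace HasSaddleBoundsOn

variable {X : Set E} {Y : Set G} {F : E → G → ℝ} {gx : E → G → E} {gy : E → G → G}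
  {μ L ν K ℓ : ℝ} {a p p' : E} {b y y' : G}

lemma add_sq_sub_sq (H : HasSaddleBoundsOn X Y F gx gy μ L ν K ℓ) (r : ℝ) {s : ℝ} (hs : 0 ≤ s)
    (z : E) :
    HasSaddleBoundsOn X Y (fun x y => F x y + r / 2 * ‖x - z‖ ^ 2 - s / 2 * ‖y‖ ^ 2)
      (fun x y => gx x y + r • (x - z)) (fun x y => gy x y - s • y)
      (μ + r) (L + r) (ν + s) (K + s) ℓ where
  left y hy :=
    { lower := fun x hx u hu => by
        linarith [((H.left hy).add_sq_norm_sub r z).lower hx hu]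
      upper := fun x hx u hu => by
        linarith [((H.left hy).add_sq_norm_sub r z).upper hx hu] }
  right x hx :=
    { lower := fun y hy v hv => by
        have hlower := ((H.right hx).add_sq_norm_sub (-s) 0).lower hy hv
        simp only [sub_zero, neg_smul, ← sub_eq_add_neg] at hlower
        linarith
      upper := fun y hy v hv => by
        have hupper := ((H.right hx).add_sq_norm_sub (-s) 0).upper hy hv
        simp only [sub_zero, neg_smul, ← sub_eq_add_neg] at hupper
        linarith }
  norm_gx_sub_le x hx y hy y' hy' := by
    simpa only [add_sub_add_right_eq_sub] using H.norm_gx_sub_le hx hy hy'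
  norm_gy_sub_le x hx x' hx' y hy y' hy' := by
    calc ‖gy x y - s • y - (gy x' y' - s • y')‖
        = ‖(gy x y - gy x' y') - s • (y - y')‖ := by rw [smul_sub, sub_sub_sub_comm]
      _ ≤ ‖gy x y - gy x' y'‖ + s * ‖y - y'‖ := by
        simpa only [norm_smul, Real.norm_of_nonneg hs] using
          norm_sub_le (gy x y - gy x' y') (s • (y - y'))
      _ ≤ ℓ * ‖x - x'‖ + (K + s) * ‖y - y'‖ := by
        linarith [H.norm_gy_sub_le hx hx' hy hy']

lemma mul_norm_sub_le_of_isMinOn (H : HasSaddleBoundsOn X Y F gx gy μ L ν K ℓ) (hX : Convex ℝ X)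
    (hy : y ∈ Y) (hy' : y' ∈ Y) (hp : p ∈ X) (hp' : p' ∈ X)
    (hmin : IsMinOn (fun x => F x y) X p) (hmin' : IsMinOn (fun x => F x y') X p') :
    μ * ‖p - p'‖ ≤ ℓ * ‖y - y'‖ :=
  ((H.left hy).mul_norm_sub_le_of_isMinOn (H.left hy') hX hp hp' hmin hmin').trans
    (H.norm_gx_sub_le hp' hy hy')

lemma norm_gy_sub_le_of_isMinOn (H : HasSaddleBoundsOn X Y F gx gy μ L ν K ℓ) (hμ : 0 < μ)
    (hℓ : 0 ≤ ℓ) (hX : Convex ℝ X) (hy : y ∈ Y) (hy' : y' ∈ Y) (hp : p ∈ X) (hp' : p' ∈ X)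
    (hmin : IsMinOn (fun x => F x y) X p) (hmin' : IsMinOn (fun x => F x y') X p') :
    ‖gy p y - gy p' y'‖ ≤ (K + ℓ ^ 2 / μ) * ‖y - y'‖ := by
  have hpp' : ‖p - p'‖ ≤ ℓ * ‖y - y'‖ / μ := by
    rw [le_div_iff₀' hμ]
    exact H.mul_norm_sub_le_of_isMinOn hX hy hy' hp hp' hmin hmin'
  calc ‖gy p y - gy p' y'‖ ≤ ℓ * ‖p - p'‖ + K * ‖y - y'‖ := H.norm_gy_sub_le hp hp' hy hy'
    _ ≤ ℓ * (ℓ * ‖y - y'‖ / μ) + K * ‖y - y'‖ := by gcongr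
    _ = (K + ℓ ^ 2 / μ) * ‖y - y'‖ := by ring

lemma add_inner_sub_sq_le_of_isMinOn (H : HasSaddleBoundsOn X Y F gx gy μ L ν K ℓ) (hμ : 0 < μ)
    (hX : Convex ℝ X) (hy : y ∈ Y) (hy' : y' ∈ Y) (hp : p ∈ X) (hp' : p' ∈ X)
    (hmin : IsMinOn (fun x => F x y) X p) :
    F p y + ⟪gy p y, y' - y⟫_ℝ - (K + ℓ ^ 2 / μ) / 2 * ‖y' - y‖ ^ 2 ≤ F p' y' := by
  have hright := (H.right hp).lower hy hy'
  have hleft := (H.left hy').lower hp hp'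
  have hopt := (H.left hy).inner_nonneg_of_isMinOn hX hp hmin hp'
  have hcross : -(ℓ * ‖y' - y‖ * ‖p' - p‖) ≤ ⟪gx p y' - gx p y, p' - p⟫_ℝ :=
    (neg_le_neg (mul_le_mul_of_nonneg_right (H.norm_gx_sub_le hp hy' hy) (norm_nonneg _))).trans
      (neg_le_of_abs_le (abs_real_inner_le_norm _ _))
  have hsquare : ℓ * ‖y' - y‖ * ‖p' - p‖
      ≤ μ / 2 * ‖p' - p‖ ^ 2 + ℓ ^ 2 / μ / 2 * ‖y' - y‖ ^ 2 := by
    have hnonneg : 0 ≤ (μ * ‖p' - p‖ - ℓ * ‖y' - y‖) ^ 2 / (2 * μ) := by positivity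
    have hexpand : (μ * ‖p' - p‖ - ℓ * ‖y' - y‖) ^ 2 / (2 * μ) = μ / 2 * ‖p' - p‖ ^ 2
        + ℓ ^ 2 / μ / 2 * ‖y' - y‖ ^ 2 - ℓ * ‖y' - y‖ * ‖p' - p‖ := by
      field_simp
      ring
    linarith
  rw [inner_sub_left] at hcross
  linarith

/-- Danskin's theorem in quadratic form. -/
lemma hasQuadraticBoundsOn_of_isMinOn (H : HasSaddleBoundsOn X Y F gx gy μ L ν K ℓ) (hμ : 0 < μ)
    (hX : Convex ℝ X) {p : G → E} (hp : ∀ v ∈ Y, p v ∈ X)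
    (hmin : ∀ v ∈ Y, IsMinOn (fun x => F x v) X (p v)) :
    HasQuadraticBoundsOn (fun v => F (p v) v) (fun v => gy (p v) v) (-(K + ℓ ^ 2 / μ)) (-ν) Y where
  lower v hv w hw := by
    linarith [H.add_inner_sub_sq_le_of_isMinOn hμ hX hv hw (hp v hv) (hp w hw) (hmin v hv)]
  upper v hv w hw := (hmin w hw (hp v hv)).trans ((H.right (hp v hv)).upper hv hw)

lemma exists_isSaddlePointOn [ProperSpace E] (H : HasSaddleBoundsOn X Y F gx gy μ L ν K ℓ)
    (hμ : 0 < μ) (hν : 0 ≤ ν) (hX : Convex ℝ X) (hXc : IsClosed X) (hX₀ : X.Nonempty)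
    (hY : Convex ℝ Y) (hYc : IsCompact Y) (hY₀ : Y.Nonempty) :
    ∃ a ∈ X, ∃ b ∈ Y, IsSaddlePointOn X Y F a b := by
  choose! p hp hmin using fun v (hv : v ∈ Y) => (H.left hv).exists_isMinOn hμ hXc hX₀
  have envelope := H.hasQuadraticBoundsOn_of_isMinOn hμ hX hp hmin
  obtain ⟨b, hb, hmax⟩ := hYc.exists_isMaxOn hY₀ envelope.continuousOn
  refine ⟨p b, hp b hb, b, hb, fun x hx v hv => ?_⟩
  have hopt := envelope.inner_nonpos_of_isMaxOn hY hb hmax hv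
  have hcurv : 0 ≤ ν * ‖v - b‖ ^ 2 := by positivity
  calc F (p b) v ≤ F (p b) b + ⟪gy (p b) b, v - b⟫_ℝ + -ν / 2 * ‖v - b‖ ^ 2 :=
        (H.right (hp b hb)).upper hb hv
    _ ≤ F (p b) b := by linarith
    _ ≤ F x b := hmin b hb hx

lemma bddAbove_image_right (H : HasSaddleBoundsOn X Y F gx gy μ L ν K ℓ) (hYc : IsCompact Y) :
    ∀ x ∈ X, BddAbove (F x '' Y) := fun _ hx =>
  (hYc.image_of_continuousOn (H.right hx).continuousOn).bddAbove

lemma sq_add_sq_le_inner_of_isSaddlePointOn (H : HasSaddleBoundsOn X Y F gx gy μ L ν K ℓ)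
    (hX : Convex ℝ X) (hY : Convex ℝ Y) (hs : IsSaddlePointOn X Y F a b) (ha : a ∈ X) (hb : b ∈ Y)
    (hy : y ∈ Y) (hp : p ∈ X) (hmin : IsMinOn (fun x => F x y) X p) :
    μ / 2 * ‖a - p‖ ^ 2 + ν * ‖b - y‖ ^ 2 ≤ ⟪gy p y, b - y⟫_ℝ := by
  have hmax : IsMaxOn (F a) Y b := fun v hv => hs a ha v hv
  have hgrowth_b := (H.right ha).neg.add_sq_le_of_isMinOn hY hb hmax.neg hy
  have hgrowth_p := (H.left hy).add_sq_le_of_isMinOn hX hp hmin ha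
  have hle : F a b ≤ F p b := hs p hp b hb
  have hmodel := (H.right hp).upper hy hb
  rw [neg_neg, norm_sub_rev y b] at hgrowth_b
  linarith

end HasSaddleBoundsOn

lemma HasSaddleBoundsOn.norm_sub_sq_le_of_projected_step {d : ℕ} {X : Set E} {Y : Set (RVec d)}
    {F : E → RVec d → ℝ} {gx : E → RVec d → E} {gy : E → RVec d → RVec d} {μ L ν K ℓ α : ℝ}
    {a p q : E} {b y y' : RVec d} (H : HasSaddleBoundsOn X Y F gx gy μ L ν K ℓ) (hμ : 0 < μ)
    (hν : 0 ≤ ν) (hℓ : 0 ≤ ℓ) (hα : 0 < α) (hX : Convex ℝ X) (hY : Convex ℝ Y)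
    (hs : IsSaddlePointOn X Y F a b) (ha : a ∈ X) (hb : b ∈ Y)
    (hy : y ∈ Y) (hp : p ∈ X) (hmin : IsMinOn (fun x => F x y) X p)
    (hy' : IsProjOnto Y (y + α • gy p y) y') (hq : q ∈ X)
    (hqmin : IsMinOn (fun x => F x y') X q) :
    2 * ν * μ * ‖a - q‖ ^ 2 ≤ ((1 / α + (K + ℓ ^ 2 / μ)) * ‖y - y'‖) ^ 2 := by
  set W := 1 / α + (K + ℓ ^ 2 / μ) with hW
  have hgrowth := H.sq_add_sq_le_inner_of_isSaddlePointOn hX hY hs ha hb hy'.1 hq hqmin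
  have hstep : ⟪gy p y, b - y'⟫_ℝ ≤ 1 / α * (‖y - y'‖ * ‖b - y'‖) := by
    have hvi := inner_add_inner_nonneg_of_step (v := -gy p y) (c := α) hY
      (by rwa [smul_neg, sub_neg_eq_add]) hb
    have hcs := real_inner_le_norm (y' - y) (b - y')
    rw [inner_neg_left] at hvi
    rw [norm_sub_rev y' y] at hcs
    rw [div_mul_eq_mul_div, one_mul, le_div_iff₀' hα]
    linarith
  have hlip : ⟪gy q y' - gy p y, b - y'⟫_ℝ ≤ (K + ℓ ^ 2 / μ) * ‖y - y'‖ * ‖b - y'‖ := by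
    refine (real_inner_le_norm _ _).trans (mul_le_mul_of_nonneg_right ?_ (norm_nonneg _))
    rw [norm_sub_rev y y']
    exact H.norm_gy_sub_le_of_isMinOn hμ hℓ hX hy'.1 hy hq hp hqmin hmin
  have hquad : μ / 2 * ‖a - q‖ ^ 2 + ν * ‖b - y'‖ ^ 2 ≤ W * ‖y - y'‖ * ‖b - y'‖ := by
    rw [inner_sub_left] at hlip
    rw [hW]
    linarith
  nlinarith [sq_nonneg (W * ‖y - y'‖ - 2 * ν * ‖b - y'‖), mul_le_mul_of_nonneg_left hquad hν]

lemma HasSaddleBoundsOn.descent_of_projected_steps {n d : ℕ} {X : Set (RVec n)} {Y : Set (RVec d)}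
    {F : RVec n → RVec d → ℝ} {gx : RVec n → RVec d → RVec n} {gy : RVec n → RVec d → RVec d}
    {μ L ν K ℓ c α : ℝ} {x x' p p' : RVec n} {y y' : RVec d}
    (H : HasSaddleBoundsOn X Y F gx gy μ L ν K ℓ) (hμ : 0 < μ) (hν : 0 ≤ ν) (hc : 0 < c)
    (hcL : c * L ≤ 1) (hα : 0 < α) (hX : Convex ℝ X) (hY : Convex ℝ Y) (hx : x ∈ X) (hy : y ∈ Y)
    (hx' : IsProjOnto X (x - c • gx x y) x') (hy' : IsProjOnto Y (y + α • gy x' y) y')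
    (hp : p ∈ X) (hmin : IsMinOn (fun u => F u y) X p) (hp' : p' ∈ X) :
    1 / (2 * c) * ‖x' - x‖ ^ 2 + 1 / α * ‖y' - y‖ ^ 2 - 2 * ℓ * ‖x' - p‖ * ‖y' - y‖
        - (K + ℓ ^ 2 / μ) * ‖y' - y‖ ^ 2
      ≤ F x y - 2 * F p y - (F x' y' - 2 * F p' y') := by
  have hprimal := (H.left hy).add_sq_le_of_projected_step hX hc hcL hx hx'
  have hdual := H.add_inner_sub_sq_le_of_isMinOn hμ hX hy hy'.1 hp hp' hmin
  have hascent : F x' y' ≤ F x' y + ⟪gy x' y, y' - y⟫_ℝ := by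
    have hcurv : 0 ≤ ν * ‖y' - y‖ ^ 2 := by positivity
    linarith [(H.right hx'.1).upper hy hy'.1]
  have hstep : 1 / α * ‖y' - y‖ ^ 2 ≤ ⟪gy x' y, y' - y⟫_ℝ := by
    have hvi := inner_add_inner_nonneg_of_step (v := -gy x' y) (c := α) hY
      (by rwa [smul_neg, sub_neg_eq_add]) hy
    rw [inner_neg_left, ← neg_sub y' y, inner_neg_right, inner_neg_right,
      real_inner_self_eq_norm_sq] at hvi
    rw [div_mul_eq_mul_div, one_mul, div_le_iff₀' hα]
    linarith
  have hcross : ⟪gy x' y - gy p y, y' - y⟫_ℝ ≤ ℓ * ‖x' - p‖ * ‖y' - y‖ := by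
    refine (real_inner_le_norm _ _).trans (mul_le_mul_of_nonneg_right ?_ (norm_nonneg _))
    simpa using H.norm_gy_sub_le hx'.1 hp hy hy
  rw [inner_sub_left] at hcross
  linarith

end SaddlePoint

section Surrogate

variable {n d : ℕ} {X : Set (RVec n)} {Y : Set (RVec d)} {f : RVec n → RVec d → ℝ}
  {ℓ rx ry : ℝ} {z : RVec n}

lemma IsSmoothOn.hasGradientAt_left (h : IsSmoothOn X Y f ℓ) (x : RVec n) (y : RVec d) :
    HasGradientAt (fun x' => f x' y) (gradX f x y) x :=
  ((h.contDiff.comp (contDiff_prodMk_left y)).differentiable one_ne_zero x).hasGradientAt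

lemma IsSmoothOn.hasGradientAt_right (h : IsSmoothOn X Y f ℓ) (x : RVec n) (y : RVec d) :
    HasGradientAt (f x) (gradY f x y) y :=
  ((h.contDiff.comp (contDiff_prodMk_right x)).differentiable one_ne_zero y).hasGradientAt

lemma hasGradientAt_half_mul_sq_norm_sub {E : Type*} [NormedAddCommGroup E]
    [InnerProductSpace ℝ E] [CompleteSpace E] (r : ℝ) (z x : E) :
    HasGradientAt (fun w => r / 2 * ‖w - z‖ ^ 2) (r • (x - z)) x := by
  rw [hasGradientAt_iff_hasFDerivAt]
  refine (((hasFDerivAt_id x).sub_const z).norm_sq.const_mul (r / 2)).congr_fderiv ?_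
  ext w
  simp
  ring

lemma gradX_surrogate (h : IsSmoothOn X Y f ℓ) (rx ry : ℝ) (z x : RVec n) (y : RVec d) :
    gradX (surrogate f rx ry z) x y = gradX f x y + rx • (x - z) := by
  refine HasGradientAt.gradient ?_
  rw [hasGradientAt_iff_hasFDerivAt, map_add]
  exact ((h.hasGradientAt_left x y).hasFDerivAt.add
    (hasGradientAt_half_mul_sq_norm_sub rx z x).hasFDerivAt).sub_const _

lemma gradY_surrogate (h : IsSmoothOn X Y f ℓ) (rx ry : ℝ) (z x : RVec n) (y : RVec d) :
    gradY (surrogate f rx ry z) x y = gradY f x y - ry • y := by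
  have hsq := (hasGradientAt_half_mul_sq_norm_sub ry 0 y).hasFDerivAt
  simp only [sub_zero] at hsq
  refine HasGradientAt.gradient ?_
  rw [hasGradientAt_iff_hasFDerivAt, map_sub]
  exact ((h.hasGradientAt_right x y).hasFDerivAt.add_const _).sub hsq

lemma surrogate_add (f : RVec n → RVec d → ℝ) (rx ry : ℝ) (z w u : RVec n) (v : RVec d) :
    surrogate f rx ry (z + w) u v
      = surrogate f rx ry z u v + rx / 2 * (‖w‖ ^ 2 - 2 * ⟪w, u - z⟫_ℝ) := by
  have hsq : ‖u - (z + w)‖ ^ 2 = ‖u - z‖ ^ 2 - 2 * ⟪w, u - z⟫_ℝ + ‖w‖ ^ 2 := by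
    rw [← sub_sub, norm_sub_sq_real, real_inner_comm]
  simp only [surrogate, hsq]
  ring

lemma omegaConst_nonneg {α : ℝ} (hℓ : 0 < ℓ) (hrx : ℓ < rx) (hα : 0 < α) :
    0 ≤ omegaConst ℓ rx ry α := by
  have : 0 < rx - ℓ := sub_pos.2 hrx
  have hsum : 0 < 3 * rx - 2 * ℓ := by linarith
  unfold omegaConst
  positivity

lemma omegaConst_sq_mul {α : ℝ} (hrx : ℓ < rx) (hry : 0 < ry) (hα : 0 < α) :
    omegaConst ℓ rx ry α ^ 2 * (2 * ry * (rx - ℓ))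
      = (1 / α + ℓ * (3 * rx - 2 * ℓ) / (rx - ℓ)) ^ 2 := by
  have hμ : 0 < rx - ℓ := sub_pos.2 hrx
  have hpow : ((rx - ℓ) ^ (3 / 2 : ℝ)) ^ 2 = (rx - ℓ) ^ 3 := by
    rw [← Real.rpow_natCast, ← Real.rpow_mul hμ.le, ← Real.rpow_natCast]
    norm_num
  rw [omegaConst, mul_pow, div_pow, div_pow, mul_pow, hpow, Real.sq_sqrt (by positivity)]
  field_simp

namespace IsNCCProblem

lemma hasSaddleBoundsOn (hP : IsNCCProblem X Y f ℓ) :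
    HasSaddleBoundsOn X Y f (gradX f) (gradY f) (-ℓ) ℓ 0 ℓ ℓ where
  left y hy := hasQuadraticBoundsOn_of_lipschitz_gradient
    (fun x => hP.smooth.hasGradientAt_left x y) hP.convex_X
    fun x hx u hu => by simpa using hP.smooth.lipX x hx u hu y hy y hy
  right x hx := by
    rw [neg_zero]
    exact hasQuadraticBoundsOn_of_concaveOn (hP.smooth.hasGradientAt_right x) (hP.concave x hx)
      fun y hy v hv => by simpa using hP.smooth.lipY x hx x hx y hy v hv
  norm_gx_sub_le x hx y hy y' hy' := by simpa using hP.smooth.lipX x hx x hx y hy y' hy'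
  norm_gy_sub_le x hx x' hx' y hy y' hy' := by
    rw [← mul_add]
    exact hP.smooth.lipY x hx x' hx' y hy y' hy'

lemma hasSaddleBoundsOn_surrogate (hP : IsNCCProblem X Y f ℓ) (hry : 0 ≤ ry) (rx : ℝ)
    (z : RVec n) :
    HasSaddleBoundsOn X Y (surrogate f rx ry z) (gradX (surrogate f rx ry z))
      (gradY (surrogate f rx ry z)) (rx - ℓ) (rx + ℓ) ry (ℓ + ry) ℓ := by
  have H := hP.hasSaddleBoundsOn.add_sq_sub_sq rx hry z
  rw [neg_add_eq_sub, add_comm ℓ rx, zero_add] at H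
  have hgx : gradX (surrogate f rx ry z) = fun x y => gradX f x y + rx • (x - z) :=
    funext₂ (gradX_surrogate hP.smooth rx ry z)
  have hgy : gradY (surrogate f rx ry z) = fun x y => gradY f x y - ry • y :=
    funext₂ (gradY_surrogate hP.smooth rx ry z)
  rw [hgx, hgy]
  exact H

lemma nonempty_Y (hP : IsNCCProblem X Y f ℓ) : Y.Nonempty := ⟨0, hP.zero_mem_Y⟩

lemma exists_isMinOn_surrogate (hP : IsNCCProblem X Y f ℓ) (hX : X.Nonempty) (hrx : ℓ < rx)
    (hry : 0 ≤ ry) (z : RVec n) {y : RVec d} (hy : y ∈ Y) :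
    ∃ p ∈ X, IsMinOn (fun u => surrogate f rx ry z u y) X p :=
  ((hP.hasSaddleBoundsOn_surrogate hry rx z).left hy).exists_isMinOn (sub_pos.2 hrx)
    hP.closed_X hX

lemma exists_isSaddlePointOn_surrogate (hP : IsNCCProblem X Y f ℓ) (hX : X.Nonempty)
    (hrx : ℓ < rx) (hry : 0 ≤ ry) (z : RVec n) :
    ∃ a ∈ X, ∃ b ∈ Y, IsSaddlePointOn X Y (surrogate f rx ry z) a b :=
  (hP.hasSaddleBoundsOn_surrogate hry rx z).exists_isSaddlePointOn (sub_pos.2 hrx) hry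
    hP.convex_X hP.closed_X hX hP.convex_Y hP.compact_Y hP.nonempty_Y

lemma bddAbove_surrogate (hP : IsNCCProblem X Y f ℓ) (hry : 0 ≤ ry) (rx : ℝ) (z : RVec n) :
    ∀ u ∈ X, BddAbove (surrogate f rx ry z u '' Y) :=
  (hP.hasSaddleBoundsOn_surrogate hry rx z).bddAbove_image_right hP.compact_Y

lemma potential_eq (hP : IsNCCProblem X Y f ℓ) (hry : 0 ≤ ry) {x p a : RVec n} {y b : RVec d}
    (hp : p ∈ X) (hmin : IsMinOn (fun u => surrogate f rx ry z u y) X p)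
    (hs : IsSaddlePointOn X Y (surrogate f rx ry z) a b) (ha : a ∈ X) (hb : b ∈ Y) :
    potential X Y f rx ry x y z = surrogate f rx ry z x y - 2 * surrogate f rx ry z p y
      + 2 * surrogate f rx ry z a b := by
  rw [potential, hmin.iInf_eq hp,
    iInf_iSup_eq_of_isSaddlePointOn hs ha hb (hP.bddAbove_surrogate hry rx z)]

lemma norm_sub_le_omegaConst_mul (hP : IsNCCProblem X Y f ℓ) (hrx : ℓ < rx) (hry : 0 < ry)
    (hryℓ : ry ≤ ℓ) {α : ℝ} (hα : 0 < α) {a p q : RVec n} {b y y' : RVec d}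
    (hs : IsSaddlePointOn X Y (surrogate f rx ry z) a b) (ha : a ∈ X) (hb : b ∈ Y) (hy : y ∈ Y)
    (hp : p ∈ X) (hmin : IsMinOn (fun u => surrogate f rx ry z u y) X p)
    (hy' : IsProjOnto Y (y + α • gradY (surrogate f rx ry z) p y) y') (hq : q ∈ X)
    (hqmin : IsMinOn (fun u => surrogate f rx ry z u y') X q) :
    ‖a - q‖ ≤ omegaConst ℓ rx ry α * ‖y - y'‖ := by
  have hℓ := hP.smooth.pos
  have hμ : 0 < rx - ℓ := sub_pos.2 hrx
  have hsq := (hP.hasSaddleBoundsOn_surrogate hry.le rx z).norm_sub_sq_le_of_projected_step hμ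
    hry.le hℓ.le hα hP.convex_X hP.convex_Y hs ha hb hy hp hmin hy' hq hqmin
  have hlip : ℓ + ry + ℓ ^ 2 / (rx - ℓ) ≤ ℓ * (3 * rx - 2 * ℓ) / (rx - ℓ) :=
    calc ℓ + ry + ℓ ^ 2 / (rx - ℓ) ≤ 3 * ℓ + ℓ ^ 2 / (rx - ℓ) := by linarith
      _ = ℓ * (3 * rx - 2 * ℓ) / (rx - ℓ) := by field_simp; ring
  have hω := omegaConst_nonneg (ry := ry) hℓ hrx hα
  refine (sq_le_sq₀ (norm_nonneg _) (by positivity)).1 (le_of_mul_le_mul_left ?_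
    (by positivity : 0 < 2 * ry * (rx - ℓ)))
  calc 2 * ry * (rx - ℓ) * ‖a - q‖ ^ 2
      ≤ ((1 / α + (ℓ + ry + ℓ ^ 2 / (rx - ℓ))) * ‖y - y'‖) ^ 2 := hsq
    _ ≤ ((1 / α + ℓ * (3 * rx - 2 * ℓ) / (rx - ℓ)) * ‖y - y'‖) ^ 2 := by gcongr
    _ = 2 * ry * (rx - ℓ) * (omegaConst ℓ rx ry α * ‖y - y'‖) ^ 2 := by
      rw [mul_pow, mul_pow, ← omegaConst_sq_mul hrx hry hα]
      ring

lemma norm_sub_le_of_isMinOn_surrogate_add (hP : IsNCCProblem X Y f ℓ) (hrx : 3 * ℓ < rx)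
    (hry : 0 ≤ ry) {w p q : RVec n} {y y' : RVec d} (hy : y ∈ Y) (hy' : y' ∈ Y) (hp : p ∈ X)
    (hq : q ∈ X) (hpmin : IsMinOn (fun u => surrogate f rx ry (z + w) u y) X p)
    (hqmin : IsMinOn (fun u => surrogate f rx ry z u y') X q) :
    ‖q - p‖ ≤ ‖y - y'‖ / 2 + 3 / 2 * ‖w‖ := by
  have hℓ := hP.smooth.pos
  have hgrad : ‖gradX (surrogate f rx ry z) p y' - gradX (surrogate f rx ry (z + w)) p y‖
      ≤ ℓ * ‖y - y'‖ + rx * ‖w‖ := by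
    have hdiff : gradX (surrogate f rx ry z) p y' - gradX (surrogate f rx ry (z + w)) p y
        = gradX f p y' - gradX f p y + rx • w := by
      rw [gradX_surrogate hP.smooth, gradX_surrogate hP.smooth]
      module
    have hlip := hP.hasSaddleBoundsOn.norm_gx_sub_le hp hy' hy
    rw [norm_sub_rev y' y] at hlip
    rw [hdiff]
    refine (norm_add_le _ _).trans (add_le_add hlip ?_)
    rw [norm_smul, Real.norm_of_nonneg (by linarith)]
  have hmin := ((hP.hasSaddleBoundsOn_surrogate hry rx z).left hy').mul_norm_sub_le_of_isMinOn
    ((hP.hasSaddleBoundsOn_surrogate hry rx (z + w)).left hy) hP.convex_X hq hp hqmin hpmin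
  refine le_of_mul_le_mul_left ((hmin.trans hgrad).trans ?_) (by linarith : 0 < rx - ℓ)
  nlinarith [norm_nonneg (y - y'), norm_nonneg w]

end IsNCCProblem

end Surrogate

section StepSize

variable {m M ℓ rx ry c α β : ℝ}

namespace StepSizeCondition

lemma c_mul_le_one (hS : StepSizeCondition m M ℓ rx ry c α β) (hℓ : 0 < ℓ) :
    c * (rx + ℓ) ≤ 1 :=
  (le_div_iff₀ (by linarith [hS.rx_gt])).1 hS.c_lt.le

lemma α_mul_le_one (hS : StepSizeCondition m M ℓ rx ry c α β) (hℓ : 0 < ℓ) :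
    11 * ℓ * α ≤ 1 :=
  (le_div_iff₀' (by positivity)).1 (le_min_iff.1 hS.α_le).1

lemma α_mul_le_sq (hS : StepSizeCondition m M ℓ rx ry c α β) (hℓ : 0 < ℓ) :
    4 * ℓ * α ≤ (c * (rx - ℓ)) ^ 2 := by
  have hc := hS.c_pos
  have hα := hS.α_pos
  have hμ : 0 < rx - ℓ := by linarith [hS.rx_gt]
  have hle := (le_div_iff₀' (by positivity)).1 (le_min_iff.1 hS.α_le).2
  calc 4 * ℓ * α ≤ 4 * ℓ * α * (1 + c * (rx - ℓ)) ^ 2 :=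
        le_mul_of_one_le_right (by positivity) (one_le_pow₀ (by linarith [mul_pos hc hμ]))
    _ = 4 * ℓ * (1 + c * (rx - ℓ)) ^ 2 * α := by ring
    _ ≤ (c * (rx - ℓ)) ^ 2 := by rwa [mul_pow]

lemma β_mul_le_one (hS : StepSizeCondition m M ℓ rx ry c α β) : 36 * β ≤ 1 := by
  linarith [(le_min_iff.1 hS.β_le).1]

lemma β_mul_omegaConst_sq_le_one (hS : StepSizeCondition m M ℓ rx ry c α β) (hℓ : 0 < ℓ) :
    384 * rx * α * omegaConst ℓ rx ry α ^ 2 * β ≤ 1 := by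
  have hα := hS.α_pos
  have hrx : 0 < rx := by linarith [hS.rx_gt]
  rcases (by positivity : 0 ≤ 384 * rx * α * omegaConst ℓ rx ry α ^ 2).eq_or_lt with h0 | h0
  · rw [← h0, zero_mul]
    exact zero_le_one
  · exact (le_div_iff₀' h0).1 hS.β_le_omega

end StepSizeCondition

variable {ω a b e g h ζ R : ℝ}

-- In the following estimates `a = ‖x' - x‖`, `b = ‖y' - y‖` and `ζ = ‖x' - z‖` measure one step of
-- the algorithm, `e = ‖x' - p‖` is the distance to the minimizer `p` of the surrogate in `x`, `g`
-- and `h` are the distances of `y` and `y'` to the ascent step `v` taken from `p`, and `R` is the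
-- distance from the saddle point to the minimizer of the shifted surrogate.
lemma two_mul_mul_mul_le_of_sq_le (hℓ : 0 ≤ ℓ) (hα : 0 < α) (hea : 4 * ℓ * α * e ^ 2 ≤ a ^ 2) :
    2 * ℓ * e * b ≤ 1 / α * b ^ 2 / 2 + ℓ * a ^ 2 / 2 :=
  calc 2 * ℓ * e * b = (1 / α * b ^ 2 + ℓ * (4 * ℓ * α * e ^ 2)) / 2
        - 1 / α * (b - 2 * ℓ * α * e) ^ 2 / 2 := by field_simp; ring
    _ ≤ (1 / α * b ^ 2 + ℓ * (4 * ℓ * α * e ^ 2)) / 2 := sub_le_self _ (by positivity)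
    _ ≤ 1 / α * b ^ 2 / 2 + ℓ * a ^ 2 / 2 := by
      linarith [mul_le_mul_of_nonneg_left hea hℓ]

lemma mul_drift_error_bound_le (hrx : 0 ≤ rx) (hα : 0 < α) (hβ : 0 ≤ β)
    (hω : 384 * rx * α * ω ^ 2 * β ≤ 1) (hg : 0 ≤ g) (hgb : g ≤ b + h)
    (hh : h ^ 2 ≤ ℓ * α * a ^ 2 / 4) :
    2 * rx * (β * ζ) * (ω * g) ≤ rx * β * ζ ^ 2 / 4 + 1 / α * b ^ 2 / 48 + ℓ * a ^ 2 / 192 := by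
  have hg_sq : g ^ 2 ≤ 2 * b ^ 2 + 2 * h ^ 2 := by
    linarith [pow_le_pow_left₀ hg hgb 2, sq_nonneg (b - h)]
  calc 2 * rx * (β * ζ) * (ω * g)
      = rx * β * ζ ^ 2 / 4 + 384 * rx * α * ω ^ 2 * β * (1 / α * g ^ 2 / 96)
        - rx * β * (ζ / 2 - 2 * ω * g) ^ 2 := by field_simp; ring
    _ ≤ rx * β * ζ ^ 2 / 4 + 384 * rx * α * ω ^ 2 * β * (1 / α * g ^ 2 / 96) :=
        sub_le_self _ (by positivity)
    _ ≤ rx * β * ζ ^ 2 / 4 + 1 / α * (2 * b ^ 2 + 2 * (ℓ * α * a ^ 2 / 4)) / 96 := by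
        refine add_le_add_right ((mul_le_of_le_one_left (by positivity) hω).trans ?_) _
        gcongr
        linarith
    _ = rx * β * ζ ^ 2 / 4 + 1 / α * b ^ 2 / 48 + ℓ * a ^ 2 / 192 := by field_simp; ring

lemma mul_drift_le (hℓ : 0 ≤ ℓ) (hrx : 0 ≤ rx) (hc : 0 < c) (hα : 0 < α) (hβ : 0 ≤ β)
    (hcL : c * (rx + ℓ) ≤ 1) (hαℓ : 11 * ℓ * α ≤ 1) (hβ36 : 36 * β ≤ 1)
    (hω : 384 * rx * α * ω ^ 2 * β ≤ 1) (hg : 0 ≤ g) (hgb : g ≤ b + h) (hζ : 0 ≤ ζ)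
    (hh : h ^ 2 ≤ ℓ * α * a ^ 2 / 4) (hR : R ≤ ω * g + (h / 2 + 3 / 2 * (β * ζ))) :
    2 * rx * (β * ζ) * R ≤ 13 / 36 * (rx * β * ζ ^ 2) + 1 / α * b ^ 2 / 48 + ℓ * a ^ 2 / 192
      + 1 / c * a ^ 2 / 176 := by
  have herror := mul_drift_error_bound_le (ζ := ζ) hrx hα hβ hω hg hgb hh
  have hcross : rx * (β * ζ) * h ≤ rx * (β * ζ) ^ 2 + 1 / c * a ^ 2 / 176 := by
    have hrxc : rx ≤ 1 / c := by
      rw [le_div_iff₀' hc]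
      linarith [mul_nonneg hc.le hℓ]
    have hrxh : rx * h ^ 2 ≤ 1 / c * a ^ 2 / 44 :=
      calc rx * h ^ 2 ≤ 1 / c * (1 * a ^ 2 / 44) := by
            gcongr
            linarith [mul_le_mul_of_nonneg_right hαℓ (sq_nonneg a)]
        _ = 1 / c * a ^ 2 / 44 := by ring
    linarith [mul_nonneg hrx (sq_nonneg (β * ζ - h / 2))]
  have hβ_sq : rx * (β * ζ) ^ 2 ≤ rx * β * ζ ^ 2 / 36 := by
    linarith [mul_le_mul_of_nonneg_right hβ36 (by positivity : 0 ≤ rx * β * ζ ^ 2)]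
  linarith [mul_le_mul_of_nonneg_left hR (by positivity : 0 ≤ 2 * rx * (β * ζ))]

lemma mul_sum_sq_le_of_drift_le (hℓ : 0 ≤ ℓ) (hrx : 3 * ℓ ≤ rx) (hc : 0 < c) (hα : 0 < α)
    (hβ : 0 ≤ β) (hcL : c * (rx + ℓ) ≤ 1) (hαℓ : 11 * ℓ * α ≤ 1) (hβ36 : 36 * β ≤ 1)
    (hcross : 2 * ℓ * e * b ≤ 1 / α * b ^ 2 / 2 + ℓ * a ^ 2 / 2)
    (hdrift : 2 * rx * (β * ζ) * R ≤ 13 / 36 * (rx * β * ζ ^ 2) + 1 / α * b ^ 2 / 48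
      + ℓ * a ^ 2 / 192 + 1 / c * a ^ 2 / 176) :
    ℓ * (a ^ 2 + b ^ 2 + β * ζ ^ 2) ≤ 1 / (2 * c) * a ^ 2 + 1 / α * b ^ 2 - 2 * ℓ * e * b
      - 5 / 2 * ℓ * b ^ 2 + rx / 2 * (2 * β - β ^ 2) * ζ ^ 2 - 2 * rx * (β * ζ) * R := by
  have hcℓ : 4 * ℓ ≤ 1 / c := by
    rw [le_div_iff₀' hc]
    linarith [mul_le_mul_of_nonneg_left hrx hc.le]
  have hαℓ' : 11 * ℓ ≤ 1 / α := (le_div_iff₀ hα).2 hαℓ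
  have hrx0 : 0 ≤ rx := by linarith
  have ha := mul_le_mul_of_nonneg_right hcℓ (sq_nonneg a)
  have hb := mul_le_mul_of_nonneg_right hαℓ' (sq_nonneg b)
  have hζ := mul_le_mul_of_nonneg_right hrx (by positivity : 0 ≤ β * ζ ^ 2)
  have hβ_sq := mul_le_mul_of_nonneg_right hβ36 (by positivity : 0 ≤ rx * β * ζ ^ 2)
  have hhalf : 1 / (2 * c) = 1 / c / 2 := by field_simp
  have : 0 ≤ ℓ * a ^ 2 := by positivity
  have : 0 ≤ ℓ * b ^ 2 := by positivity
  have : 0 ≤ ℓ * (β * ζ ^ 2) := by positivity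
  rw [hhalf]
  linarith

end StepSize

section Descent

variable {n d : ℕ} {X : Set (RVec n)} {Y : Set (RVec d)} {f : RVec n → RVec d → ℝ}
  {m M ℓ rx ry c α β : ℝ}

namespace IsNCCProblem

variable {x x' z p p' a q : RVec n} {y y' v b : RVec d}

lemma le_potential_sub_potential (hP : IsNCCProblem X Y f ℓ) (hrx : 3 * ℓ < rx) (hry : 0 ≤ ry)
    (hryℓ : ry ≤ ℓ) (hc : 0 < c) (hcL : c * (rx + ℓ) ≤ 1) (hα : 0 < α) (hβ : 0 ≤ β) (hx : x ∈ X)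
    (hy : y ∈ Y) (hx' : IsProjOnto X (x - c • gradX (surrogate f rx ry z) x y) x')
    (hy' : IsProjOnto Y (y + α • gradY (surrogate f rx ry z) x' y) y') (hp : p ∈ X)
    (hmin : IsMinOn (fun u => surrogate f rx ry z u y) X p) (hp' : p' ∈ X)
    (hmin' : IsMinOn (fun u => surrogate f rx ry (z + β • (x' - z)) u y') X p') (ha : a ∈ X)
    (hb : b ∈ Y) (hs : IsSaddlePointOn X Y (surrogate f rx ry z) a b) :
    1 / (2 * c) * ‖x' - x‖ ^ 2 + 1 / α * ‖y' - y‖ ^ 2 - 2 * ℓ * ‖x' - p‖ * ‖y' - y‖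
        - 5 / 2 * ℓ * ‖y' - y‖ ^ 2 + rx / 2 * (2 * β - β ^ 2) * ‖x' - z‖ ^ 2
        - 2 * rx * (β * ‖x' - z‖) * ‖a - p'‖
      ≤ potential X Y f rx ry x y z - potential X Y f rx ry x' y' (z + β • (x' - z)) := by
  have hℓ := hP.smooth.pos
  have hμ : 0 < rx - ℓ := by linarith
  set w := β • (x' - z) with hw
  have hw_norm : ‖w‖ = β * ‖x' - z‖ := by rw [hw, norm_smul, Real.norm_of_nonneg hβ]
  obtain ⟨a', ha', b', hb', hs'⟩ :=
    hP.exists_isSaddlePointOn_surrogate ⟨x, hx⟩ (sub_pos.1 hμ) hry (z + w)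
  rw [hP.potential_eq hry hp hmin hs ha hb, hP.potential_eq hry hp' hmin' hs' ha' hb']
  have hdescent := (hP.hasSaddleBoundsOn_surrogate hry rx z).descent_of_projected_steps hμ hry hc
    hcL hα hP.convex_X hP.convex_Y hx hy hx' hy' hp hmin hp'
  have hcurv : (ℓ + ry + ℓ ^ 2 / (rx - ℓ)) * ‖y' - y‖ ^ 2 ≤ 5 / 2 * ℓ * ‖y' - y‖ ^ 2 := by
    refine mul_le_mul_of_nonneg_right ?_ (sq_nonneg _)
    have : ℓ ^ 2 / (rx - ℓ) ≤ ℓ / 2 := by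
      rw [div_le_iff₀ hμ]
      nlinarith
    linarith
  have hsaddle := hs a ha b' hb'
  have hsaddle' := hs' a ha b' hb'
  have hinner : ⟪w, x' - z⟫_ℝ = β * ‖x' - z‖ ^ 2 := by
    rw [hw, real_inner_smul_left, real_inner_self_eq_norm_sq]
  have hcs := mul_le_mul_of_nonneg_left (neg_le_of_abs_le (abs_real_inner_le_norm w (a - p')))
    (by linarith : 0 ≤ 2 * rx)
  rw [← sub_sub_sub_cancel_right a p' z, inner_sub_right, sub_sub_sub_cancel_right,
    hw_norm] at hcs
  simp only [surrogate_add, hinner, hw_norm] at hsaddle' ⊢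
  linarith

lemma norm_sub_le_of_isProjOnto_gradY (hP : IsNCCProblem X Y f ℓ) (hα : 0 ≤ α) (hx : x ∈ X)
    (hp : p ∈ X) (hy : y ∈ Y) (hy' : IsProjOnto Y (y + α • gradY (surrogate f rx ry z) x y) y')
    (hv : IsProjOnto Y (y + α • gradY (surrogate f rx ry z) p y) v) :
    ‖y' - v‖ ≤ α * ℓ * ‖x - p‖ := by
  refine (hy'.norm_sub_le hv hP.convex_Y).trans ?_
  rw [add_sub_add_left_eq_sub, ← smul_sub, norm_smul, Real.norm_of_nonneg hα, mul_assoc,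
    gradY_surrogate hP.smooth, gradY_surrogate hP.smooth, sub_sub_sub_cancel_right]
  gcongr
  simpa using hP.smooth.lipY x hx p hp y hy y hy

lemma sq_norm_sub_le_of_isProjOnto_gradX (hP : IsNCCProblem X Y f ℓ)
    (hS : StepSizeCondition m M ℓ rx ry c α β) (hx : x ∈ X) (hy : y ∈ Y)
    (hx' : IsProjOnto X (x - c • gradX (surrogate f rx ry z) x y) x') (hp : p ∈ X)
    (hmin : IsMinOn (fun u => surrogate f rx ry z u y) X p) :
    4 * ℓ * α * ‖x' - p‖ ^ 2 ≤ ‖x' - x‖ ^ 2 := by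
  have hℓ := hP.smooth.pos
  have hc := hS.c_pos
  have hμ : 0 ≤ rx - ℓ := by linarith [hS.rx_gt]
  have hstep := ((hP.hasSaddleBoundsOn_surrogate hS.ry_pos.le rx z).left
    hy).mul_norm_sub_le_of_projected_step hP.convex_X hc (by linarith) (hS.c_mul_le_one hℓ) hx
      hx' hp hmin
  calc 4 * ℓ * α * ‖x' - p‖ ^ 2 ≤ (c * (rx - ℓ)) ^ 2 * ‖x' - p‖ ^ 2 := by
        gcongr
        exact hS.α_mul_le_sq hℓ
    _ = (c * (rx - ℓ) * ‖x' - p‖) ^ 2 := (mul_pow _ _ _).symm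
    _ ≤ ‖x' - x‖ ^ 2 := pow_le_pow_left₀ (by positivity) hstep 2

lemma potential_descent (hP : IsNCCProblem X Y f ℓ) (hS : StepSizeCondition m M ℓ rx ry c α β)
    (hryℓ : ry ≤ ℓ) (hx : x ∈ X) (hy : y ∈ Y)
    (hx' : IsProjOnto X (x - c • gradX (surrogate f rx ry z) x y) x')
    (hy' : IsProjOnto Y (y + α • gradY (surrogate f rx ry z) x' y) y') :
    ℓ * (‖x' - x‖ ^ 2 + ‖y' - y‖ ^ 2 + β * ‖x' - z‖ ^ 2)
      ≤ potential X Y f rx ry x y z - potential X Y f rx ry x' y' (z + β • (x' - z)) := by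
  have hℓ := hP.smooth.pos
  have hc := hS.c_pos
  have hα := hS.α_pos
  have hβ := hS.β_pos
  have hry := hS.ry_pos
  have hrx3 := hS.rx_gt
  have hrx : ℓ < rx := by linarith
  obtain ⟨p, hp, hmin⟩ := hP.exists_isMinOn_surrogate ⟨x, hx⟩ hrx hry.le z hy
  obtain ⟨p', hp', hmin'⟩ :=
    hP.exists_isMinOn_surrogate ⟨x, hx⟩ hrx hry.le (z + β • (x' - z)) hy'.1
  obtain ⟨a, ha, b, hb, hs⟩ := hP.exists_isSaddlePointOn_surrogate ⟨x, hx⟩ hrx hry.le z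
  -- The dual error bound holds for the ascent step `v` from the exact minimizer `p`, not for `y'`.
  obtain ⟨v, hv⟩ := exists_isProjOnto hP.compact_Y hP.nonempty_Y
    (y + α • gradY (surrogate f rx ry z) p y)
  obtain ⟨q, hq, hqmin⟩ := hP.exists_isMinOn_surrogate ⟨x, hx⟩ hrx hry.le z hv.1
  have herror := hP.sq_norm_sub_le_of_isProjOnto_gradX hS hx hy hx' hp hmin
  have hdual : ‖y' - v‖ ≤ α * ℓ * ‖x' - p‖ :=
    hP.norm_sub_le_of_isProjOnto_gradY hα.le hx'.1 hp hy hy' hv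
  have hdual_sq : ‖y' - v‖ ^ 2 ≤ ℓ * α * ‖x' - x‖ ^ 2 / 4 := by
    have := mul_le_mul_of_nonneg_left herror (by positivity : 0 ≤ ℓ * α)
    linarith [pow_le_pow_left₀ (norm_nonneg _) hdual 2]
  have htriangle : ‖y - v‖ ≤ ‖y' - y‖ + ‖y' - v‖ := by
    rw [norm_sub_rev y' y]
    exact norm_sub_le_norm_sub_add_norm_sub y y' v
  have hdrift : ‖a - p'‖ ≤ omegaConst ℓ rx ry α * ‖y - v‖
      + (‖y' - v‖ / 2 + 3 / 2 * (β * ‖x' - z‖)) := by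
    have hω := hP.norm_sub_le_omegaConst_mul hrx hry hryℓ hα hs ha hb hy hp hmin hv hq hqmin
    have hmove := hP.norm_sub_le_of_isMinOn_surrogate_add hrx3 hry.le hy'.1 hv.1 hp' hq hmin' hqmin
    rw [norm_smul, Real.norm_of_nonneg hβ.le] at hmove
    exact (norm_sub_le_norm_sub_add_norm_sub a q p').trans (add_le_add hω hmove)
  refine (mul_sum_sq_le_of_drift_le hℓ.le hrx3.le hc hα hβ.le (hS.c_mul_le_one hℓ)
    (hS.α_mul_le_one hℓ) hS.β_mul_le_one (two_mul_mul_mul_le_of_sq_le hℓ.le hα herror)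
    (mul_drift_le hℓ.le (hℓ.trans hrx).le hc hα hβ.le (hS.c_mul_le_one hℓ) (hS.α_mul_le_one hℓ)
      hS.β_mul_le_one (hS.β_mul_omegaConst_sq_le_one hℓ) (norm_nonneg _) htriangle
      (norm_nonneg _) hdual_sq hdrift)).trans ?_
  exact hP.le_potential_sub_potential hrx3 hry.le hryℓ hc (hS.c_mul_le_one hℓ) hα hβ.le hx hy hx'
    hy' hp hmin hp' hmin' ha hb hs

lemma norm_le_diam (hP : IsNCCProblem X Y f ℓ) (hy : y ∈ Y) : ‖y‖ ≤ Metric.diam Y := by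
  simpa using Metric.dist_le_diam_of_mem hP.compact_Y.isBounded hy hP.zero_mem_Y

lemma bddAbove_pertObj (hP : IsNCCProblem X Y f ℓ) (hry : 0 ≤ ry) (hx : x ∈ X) :
    BddAbove (range fun v : Y => pertObj f ry x v) := by
  have h := hP.bddAbove_surrogate hry 0 0 x hx
  rw [image_eq_range] at h
  simpa only [surrogate, pertObj, zero_div, zero_mul, add_zero] using h

lemma bddBelow_iSup_pertObj (hP : IsNCCProblem X Y f ℓ) (hry : 0 ≤ ry) :
    BddBelow (range fun u : X => ⨆ v : Y, pertObj f ry u v) := by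
  have : Nonempty Y := hP.nonempty_Y.to_subtype
  obtain ⟨B, hB⟩ := hP.bddBelow
  refine ⟨B - ry / 2 * Metric.diam Y ^ 2, ?_⟩
  rintro _ ⟨u, rfl⟩
  rw [sub_le_iff_le_add]
  refine (hB ⟨u, u.2, rfl⟩).trans (ciSup_le fun v => ?_)
  have hv := le_ciSup (hP.bddAbove_pertObj hry u.2) v
  have hdiam : ry / 2 * ‖(v : RVec d)‖ ^ 2 ≤ ry / 2 * Metric.diam Y ^ 2 := by
    gcongr
    exact hP.norm_le_diam v.2
  simp only [pertObj] at hv ⊢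
  linarith

lemma iInf_iSup_pertObj_le_potential (hP : IsNCCProblem X Y f ℓ) (hrx : ℓ < rx) (hry : 0 ≤ ry)
    (hx : x ∈ X) (hy : y ∈ Y) :
    ⨅ u : X, ⨆ v : Y, pertObj f ry u v ≤ potential X Y f rx ry x y z := by
  have hrx0 : 0 < rx := hP.smooth.pos.trans hrx
  have : Nonempty Y := hP.nonempty_Y.to_subtype
  obtain ⟨p, hp, hmin⟩ := hP.exists_isMinOn_surrogate ⟨x, hx⟩ hrx hry z hy
  obtain ⟨a, ha, b, hb, hs⟩ := hP.exists_isSaddlePointOn_surrogate ⟨x, hx⟩ hrx hry z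
  rw [hP.potential_eq hry hp hmin hs ha hb]
  have hprimal : surrogate f rx ry z p y ≤ surrogate f rx ry z x y := hmin hx
  have hsaddle : surrogate f rx ry z p y ≤ surrogate f rx ry z a b :=
    (hmin ha).trans (hs a ha y hy)
  have hvalue : ⨅ u : X, ⨆ v : Y, pertObj f ry u v ≤ surrogate f rx ry z a b :=
    (ciInf_le (hP.bddBelow_iSup_pertObj hry) ⟨a, ha⟩).trans <| ciSup_le fun v => by
      refine le_trans ?_ (hs a ha v v.2)
      have : 0 ≤ rx / 2 * ‖a - z‖ ^ 2 := by positivity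
      simp only [pertObj, surrogate]
      linarith
  linarith

end IsNCCProblem

namespace IsPerturbedSmoothedGDA

variable {x : ℕ → RVec n} {y : ℕ → RVec d} {z : ℕ → RVec n}

lemma x_mem (hG : IsPerturbedSmoothedGDA X Y f rx ry c α β x y z) : ∀ t, x t ∈ X
  | 0 => hG.init_x
  | t + 1 => (hG.step_x t).1

lemma y_mem (hG : IsPerturbedSmoothedGDA X Y f rx ry c α β x y z) : ∀ t, y t ∈ Y
  | 0 => hG.init_y
  | t + 1 => (hG.step_y t).1

lemma exists_small_step (hG : IsPerturbedSmoothedGDA X Y f rx ry c α β x y z)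
    (hP : IsNCCProblem X Y f ℓ) (hS : StepSizeCondition m M ℓ rx ry c α β) (hryℓ : ry ≤ ℓ)
    {δ : ℝ} (hδ : 0 < δ) :
    ∃ t : ℕ, (t : ℝ) ≤ initialGap X Y f rx ry (x 0) (y 0) (z 0) / δ ∧
      ℓ * (‖x (t + 1) - x t‖ ^ 2 + ‖y (t + 1) - y t‖ ^ 2 + β * ‖x (t + 1) - z t‖ ^ 2) ≤ δ := by
  refine exists_le_of_forall_le_sub (Ψ := fun t => potential X Y f rx ry (x t) (y t) (z t)) hδ
    (fun t => hP.iInf_iSup_pertObj_le_potential ?_ hS.ry_pos.le (hG.x_mem t) (hG.y_mem t))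
    fun t => ?_
  · linarith [hP.smooth.pos, hS.rx_gt]
  · simp only [hG.step_z t]
    exact hP.potential_descent hS hryℓ (hG.x_mem t) (hG.y_mem t) (hG.step_x t) (hG.step_y t)

end IsPerturbedSmoothedGDA

end Descent

section Residuals

variable {n d : ℕ} {X : Set (RVec n)} {Y : Set (RVec d)} {f : RVec n → RVec d → ℝ}
  {m M ℓ rx ry c α β εx εy : ℝ}

/-- Approximate game stationarity with separate tolerances for the two players, each one witnessed
by an element of the subdifferential instead of a distance to it, so that the variational
inequality at `(x, y)` can be read off directly. -/
def HasGameResiduals (X : Set (RVec n)) (Y : Set (RVec d)) (f : RVec n → RVec d → ℝ) (εx εy : ℝ)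
    (x : RVec n) (y : RVec d) : Prop :=
  (∃ v ∈ indicatorSubdiff X x, ‖gradX f x y + v‖ ≤ εx) ∧
    ∃ w ∈ indicatorSubdiff Y y, ‖-gradY f x y + w‖ ≤ εy

lemma HasGameResiduals.mono {εx' εy' : ℝ} {x : RVec n} {y : RVec d}
    (h : HasGameResiduals X Y f εx εy x y) (hεx : εx ≤ εx') (hεy : εy ≤ εy') :
    HasGameResiduals X Y f εx' εy' x y := by
  obtain ⟨⟨v, hv, hv_le⟩, w, hw, hw_le⟩ := h
  exact ⟨⟨v, hv, hv_le.trans hεx⟩, w, hw, hw_le.trans hεy⟩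

lemma HasGameResiduals.isGameStationary {ε : ℝ} {x : RVec n} {y : RVec d}
    (h : HasGameResiduals X Y f ε ε x y) : IsGameStationary X Y f ε x y := by
  obtain ⟨⟨v, hv, hv_le⟩, w, hw, hw_le⟩ := h
  refine ⟨hv.1, hw.1, (Metric.infDist_le_dist_of_mem (mem_image_of_mem _ hv)).trans ?_,
    (Metric.infDist_le_dist_of_mem (mem_image_of_mem _ hw)).trans ?_⟩
  · rwa [dist_zero_left]
  · rwa [dist_zero_left]

lemma neg_mul_norm_sub_le_inner_of_mem_indicatorSubdiff {K : Set (RVec n)} {g v x u : RVec n}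
    {ε : ℝ} (hv : v ∈ indicatorSubdiff K x) (hε : ‖g + v‖ ≤ ε) (hu : u ∈ K) :
    -(ε * ‖u - x‖) ≤ ⟪g, u - x⟫_ℝ := by
  have hcs := neg_le_of_abs_le (abs_real_inner_le_norm (g + v) (u - x))
  rw [inner_add_left] at hcs
  linarith [hv.2 u hu, mul_le_mul_of_nonneg_right hε (norm_nonneg (u - x))]

lemma IsProjOnto.exists_norm_add_le {K : Set (RVec n)} {g g' x p : RVec n}
    (hp : IsProjOnto K (x - c • g) p) (hK : Convex ℝ K) (hc : 0 < c) :
    ∃ v ∈ indicatorSubdiff K p, ‖g' + v‖ ≤ 1 / c * ‖p - x‖ + ‖g' - g‖ := by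
  have hs : 0 ≤ 1 / c := by positivity
  refine ⟨_, hp.smul_sub_mem_indicatorSubdiff hK hs, ?_⟩
  have hsplit : g' + (1 / c) • (x - c • g - p) = (1 / c) • (x - p) + (g' - g) := by
    rw [sub_right_comm, smul_sub, smul_smul, one_div_mul_cancel hc.ne', one_smul]
    abel
  rw [hsplit, norm_sub_rev p x]
  refine (norm_add_le _ _).trans_eq ?_
  rw [norm_smul, Real.norm_of_nonneg hs]

lemma IsNCCProblem.hasGameResiduals_of_step {x x' z : RVec n} {y y' : RVec d}
    (hP : IsNCCProblem X Y f ℓ) (hc : 0 < c) (hα : 0 < α) (hrx : 0 ≤ rx) (hry : 0 ≤ ry)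
    (hx : x ∈ X) (hy : y ∈ Y) (hx' : IsProjOnto X (x - c • gradX (surrogate f rx ry z) x y) x')
    (hy' : IsProjOnto Y (y + α • gradY (surrogate f rx ry z) x' y) y') :
    HasGameResiduals X Y f
      ((1 / c + ℓ + rx) * ‖x' - x‖ + ℓ * ‖y' - y‖ + rx * ‖x' - z‖)
      ((1 / α + ℓ) * ‖y' - y‖ + ry * Metric.diam Y) x' y' := by
  constructor
  · obtain ⟨v, hv, hv_le⟩ := hx'.exists_norm_add_le (g' := gradX f x' y') hP.convex_X hc
    refine ⟨v, hv, hv_le.trans ?_⟩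
    have hsplit : gradX f x' y' - gradX (surrogate f rx ry z) x y
        = (gradX f x' y' - gradX f x y) + rx • ((x' - x) - (x' - z)) := by
      rw [gradX_surrogate hP.smooth, sub_sub_sub_cancel_left, ← neg_sub x z]
      module
    have hprox := norm_sub_le (x' - x) (x' - z)
    have hnorm := norm_add_le (gradX f x' y' - gradX f x y) (rx • ((x' - x) - (x' - z)))
    rw [norm_smul, Real.norm_of_nonneg hrx] at hnorm
    rw [hsplit]
    linarith [hP.smooth.lipX x' hx'.1 x hx y' hy'.1 y hy, mul_le_mul_of_nonneg_left hprox hrx]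
  · rw [← sub_neg_eq_add, ← smul_neg] at hy'
    obtain ⟨w, hw, hw_le⟩ := hy'.exists_norm_add_le (g' := -gradY f x' y') hP.convex_Y hα
    refine ⟨w, hw, hw_le.trans ?_⟩
    have hsplit : -gradY f x' y' - -gradY (surrogate f rx ry z) x' y
        = -(gradY f x' y' - gradY f x' y) - ry • y := by
      rw [gradY_surrogate hP.smooth]
      abel
    have hnorm := norm_sub_le (-(gradY f x' y' - gradY f x' y)) (ry • y)
    have hlip := hP.smooth.lipY x' hx'.1 x' hx'.1 y' hy'.1 y hy
    rw [sub_self, norm_zero, zero_add] at hlip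
    rw [norm_neg, norm_smul, Real.norm_of_nonneg hry] at hnorm
    rw [hsplit]
    linarith [mul_le_mul_of_nonneg_left (hP.norm_le_diam hy) hry]

/-- A constant `A` such that `1 / c + ℓ + rx ≤ A * ℓ` and `1 / α + ℓ ≤ A * ℓ` for all parameters
satisfying the step-size condition; it converts the length of a step into a residual. -/
noncomputable def residualConst (m M : ℝ) : ℝ := 1 / m + 1 + |M|

lemma residualConst_pos (hm : 0 < m) : 0 < residualConst m M := by
  unfold residualConst
  positivity

namespace StepSizeCondition

lemma one_div_c_add_le (hS : StepSizeCondition m M ℓ rx ry c α β) (hm : 0 < m) (hℓ : 0 < ℓ) :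
    1 / c + ℓ + rx ≤ residualConst m M * ℓ := by
  have hc : 1 / c ≤ 1 / m * ℓ := by
    simpa [mul_comm] using one_div_le_one_div_of_le (by positivity) hS.c_theta.1
  unfold residualConst
  linarith [hS.rx_theta.2, mul_le_mul_of_nonneg_right (le_abs_self M) hℓ.le]

lemma one_div_α_add_le (hS : StepSizeCondition m M ℓ rx ry c α β) (hm : 0 < m) (hℓ : 0 < ℓ) :
    1 / α + ℓ ≤ residualConst m M * ℓ := by
  have hα : 1 / α ≤ 1 / m * ℓ := by
    simpa [mul_comm] using one_div_le_one_div_of_le (by positivity) hS.α_theta.1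
  unfold residualConst
  linarith [mul_nonneg (abs_nonneg M) hℓ.le]

end StepSizeCondition

lemma norms_le_of_mul_sum_sq_le {a b ζ δ s : ℝ} (hℓ : 0 < ℓ) (hβ : 0 < β) (hβ1 : β ≤ 1)
    (hs : 0 ≤ s) (h : ℓ * (a ^ 2 + b ^ 2 + β * ζ ^ 2) ≤ δ) (hδ : δ ≤ ℓ * (β * s ^ 2)) :
    a ≤ s ∧ b ≤ s ∧ ζ ≤ s := by
  have hsum := le_of_mul_le_mul_left (h.trans hδ) hℓ
  have hβs : β * s ^ 2 ≤ s ^ 2 := mul_le_of_le_one_left (sq_nonneg s) hβ1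
  have hβζ : 0 ≤ β * ζ ^ 2 := by positivity
  exact ⟨abs_le_of_sq_le_sq' (by linarith [sq_nonneg b]) hs |>.2,
    abs_le_of_sq_le_sq' (by linarith [sq_nonneg a]) hs |>.2,
    abs_le_of_sq_le_sq' (le_of_mul_le_mul_left (by linarith [sq_nonneg a, sq_nonneg b]) hβ) hs
      |>.2⟩

lemma IsPerturbedSmoothedGDA.exists_hasGameResiduals {x : ℕ → RVec n} {y : ℕ → RVec d}
    {z : ℕ → RVec n} {δ s s' : ℝ} (hG : IsPerturbedSmoothedGDA X Y f rx ry c α β x y z)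
    (hP : IsNCCProblem X Y f ℓ) (hS : StepSizeCondition m M ℓ rx ry c α β) (hryℓ : ry ≤ ℓ)
    (hm : 0 < m) (hs : 0 ≤ s) (hs' : 0 ≤ s') (hδ : 0 < δ) (hδs : δ ≤ ℓ * (β * s ^ 2))
    (hδs' : δ ≤ ℓ * s' ^ 2) :
    ∃ t : ℕ, (t : ℝ) ≤ initialGap X Y f rx ry (x 0) (y 0) (z 0) / δ ∧
      HasGameResiduals X Y f (3 * residualConst m M * (ℓ * s))
        (residualConst m M * (ℓ * s') + ry * Metric.diam Y) (x (t + 1)) (y (t + 1)) := by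
  have hℓ := hP.smooth.pos
  have hβ := hS.β_pos
  have hrx : 0 < rx := by linarith [hS.rx_gt]
  obtain ⟨t, ht, hstep⟩ := hG.exists_small_step hP hS hryℓ hδ
  refine ⟨t, ht, (hP.hasGameResiduals_of_step hS.c_pos hS.α_pos hrx.le hS.ry_pos.le
    (hG.x_mem t) (hG.y_mem t) (hG.step_x t) (hG.step_y t)).mono ?_ ?_⟩
  · obtain ⟨ha, hb, hζ⟩ :=
      norms_le_of_mul_sum_sq_le hℓ hβ (by linarith [hS.β_mul_le_one]) hs hstep hδs
    have hA := hS.one_div_c_add_le hm hℓ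
    have hAℓ : 0 ≤ residualConst m M * ℓ := (mul_pos (residualConst_pos hm) hℓ).le
    have hc : 0 < 1 / c := one_div_pos.2 hS.c_pos
    calc (1 / c + ℓ + rx) * ‖x (t + 1) - x t‖ + ℓ * ‖y (t + 1) - y t‖ + rx * ‖x (t + 1) - z t‖
        ≤ residualConst m M * ℓ * s + residualConst m M * ℓ * s + residualConst m M * ℓ * s := by
          gcongr <;> linarith
      _ = 3 * residualConst m M * (ℓ * s) := by ring
  · have hb : ‖y (t + 1) - y t‖ ≤ s' := by
      refine (abs_le_of_sq_le_sq' (le_of_mul_le_mul_left ?_ hℓ) hs').2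
      refine le_trans ?_ (hstep.trans hδs')
      gcongr
      nlinarith [sq_nonneg ‖x (t + 1) - x t‖, sq_nonneg ‖x (t + 1) - z t‖]
    rw [← mul_assoc]
    have hAℓ : 0 ≤ residualConst m M * ℓ := (mul_pos (residualConst_pos hm) hℓ).le
    have hA := hS.one_div_α_add_le hm hℓ
    gcongr

lemma surrogate_two_mul_zero (f : RVec n → RVec d → ℝ) (ℓ : ℝ) (x u : RVec n) (v : RVec d) :
    surrogate f (2 * ℓ) 0 x u v = f u v + ℓ * ‖u - x‖ ^ 2 := by
  rw [surrogate]
  ring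

lemma IsNCCProblem.isProx_of_isSaddlePointOn {x p : RVec n} {b : RVec d}
    (hP : IsNCCProblem X Y f ℓ) (hp : p ∈ X) (hb : b ∈ Y)
    (hs : IsSaddlePointOn X Y (surrogate f (2 * ℓ) 0 x) p b) :
    IsProx X Y f (1 / (2 * ℓ)) x p := by
  have hℓ := hP.smooth.pos
  have hcoeff : 1 / (2 * (1 / (2 * ℓ))) = ℓ := by field_simp
  have hvalue : EqOn (fun u => ⨆ v : Y, surrogate f (2 * ℓ) 0 x u v)
      (fun u => primalValue Y f u + 1 / (2 * (1 / (2 * ℓ))) * ‖u - x‖ ^ 2) X := by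
    intro u hu
    have hbdd := hP.hasSaddleBoundsOn.bddAbove_image_right hP.compact_Y u hu
    rw [image_eq_range] at hbdd
    have : Nonempty Y := hP.nonempty_Y.to_subtype
    simp only [surrogate_two_mul_zero, primalValue, hcoeff, ciSup_add hbdd]
  have hmin := isMinOn_iSup_of_isSaddlePointOn hs hp hb (hP.bddAbove_surrogate le_rfl (2 * ℓ) x)
  exact ⟨hp, hmin.congr hvalue.eventuallyEq (hvalue hp)⟩

lemma IsNCCProblem.exists_isProx_of_hasGameResiduals {x : RVec n} {y : RVec d}
    (hP : IsNCCProblem X Y f ℓ) (h : HasGameResiduals X Y f εx εy x y) :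
    ∃ p, IsProx X Y f (1 / (2 * ℓ)) x p ∧
      ℓ * ‖p - x‖ ^ 2 ≤ εx * ‖p - x‖ + εy * Metric.diam Y := by
  obtain ⟨⟨v, hv, hv_le⟩, w, hw, hw_le⟩ := h
  obtain ⟨hx, hy⟩ := And.intro hv.1 hw.1
  have hℓ := hP.smooth.pos
  obtain ⟨p, hp, b, hb, hs⟩ :=
    hP.exists_isSaddlePointOn_surrogate ⟨x, hx⟩ (by linarith : ℓ < 2 * ℓ) le_rfl x
  refine ⟨p, hP.isProx_of_isSaddlePointOn hp hb hs, ?_⟩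
  have hmin : IsMinOn (fun u => surrogate f (2 * ℓ) 0 x u b) X p := fun u hu => hs u hu b hb
  have hgrowth := ((hP.hasSaddleBoundsOn_surrogate le_rfl (2 * ℓ) x).left
    hb).add_sq_le_of_isMinOn hP.convex_X hp hmin hx
  have hmax := hs p hp y hy
  simp only [surrogate_two_mul_zero, sub_self, norm_zero, norm_sub_rev x p] at hgrowth hmax
  have hconcave := (hP.hasSaddleBoundsOn.right hx).upper hy hb
  have hconvex := (hP.hasSaddleBoundsOn.left hy).lower hx hp
  have hprimal := neg_mul_norm_sub_le_inner_of_mem_indicatorSubdiff hv hv_le hp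
  have hdual := neg_mul_norm_sub_le_inner_of_mem_indicatorSubdiff hw hw_le hb
  have hdiam : εy * ‖b - y‖ ≤ εy * Metric.diam Y := by
    rw [← dist_eq_norm]
    exact mul_le_mul_of_nonneg_left (Metric.dist_le_diam_of_mem hP.compact_Y.isBounded hb hy)
      ((norm_nonneg _).trans hw_le)
  rw [inner_neg_left] at hdual
  linarith

end Residuals

section Complexity

variable {n d : ℕ} {X : Set (RVec n)} {Y : Set (RVec d)} {f : RVec n → RVec d → ℝ}
  {m M ℓ rx ry c α β κ τ ε : ℝ} {x : ℕ → RVec n} {y : ℕ → RVec d} {z : ℕ → RVec n}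

lemma StepSizeCondition.mul_div_le_β (hS : StepSizeCondition m M ℓ rx ry c α β) {r : ℝ}
    (hm : 0 < m) (hℓ : 0 < ℓ) (hr : r ≤ ry) : m * (r / ℓ) ≤ β :=
  le_trans (by gcongr) hS.β_theta.1

theorem IsPerturbedSmoothedGDA.exists_isGameStationary
    (hG : IsPerturbedSmoothedGDA X Y f rx ry c α β x y z) (hP : IsNCCProblem X Y f ℓ)
    (hS : StepSizeCondition m M ℓ rx ry c α β) (hryℓ : ry ≤ ℓ) (hm : 0 < m) (hτ : 0 < τ)
    (hκτ : κ + 3 * residualConst m M * τ ≤ 1) (hε : 0 < ε)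
    (hθ : IsThetaWith m κ ry (ε / Metric.diam Y)) :
    ∃ t : ℕ, (t : ℝ) ≤ 1 / (τ ^ 2 * m ^ 2) * (ℓ ^ 2 * Metric.diam Y *
        initialGap X Y f rx ry (x 0) (y 0) (z 0) / ε ^ 3) ∧
      IsGameStationary X Y f ε (x (t + 1)) (y (t + 1)) := by
  have hℓ := hP.smooth.pos
  have hD := hP.diam_pos
  have hA := residualConst_pos (M := M) hm
  have hβ := hS.mul_div_le_β hm hℓ hθ.1
  have hryD : ry * Metric.diam Y ≤ κ * ε := by
    rw [← div_mul_cancel₀ ε hD.ne', ← mul_assoc]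
    exact mul_le_mul_of_nonneg_right hθ.2 hD.le
  have hδ : τ ^ 2 * m ^ 2 * ε ^ 3 / (ℓ ^ 2 * Metric.diam Y) ≤ ℓ * (β * (τ * ε / ℓ) ^ 2) :=
    calc τ ^ 2 * m ^ 2 * ε ^ 3 / (ℓ ^ 2 * Metric.diam Y)
        = ℓ * (m * (m * (ε / Metric.diam Y) / ℓ) * (τ * ε / ℓ) ^ 2) := by field_simp
      _ ≤ ℓ * (β * (τ * ε / ℓ) ^ 2) := by gcongr
  have hδ' : ℓ * (β * (τ * ε / ℓ) ^ 2) ≤ ℓ * (τ * ε / ℓ) ^ 2 := by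
    gcongr
    exact mul_le_of_le_one_left (sq_nonneg _) (by linarith [hS.β_mul_le_one])
  have hs : 0 ≤ τ * ε / ℓ := by positivity
  obtain ⟨t, ht, hres⟩ := hG.exists_hasGameResiduals hP hS hryℓ hm hs hs (by positivity) hδ
    (hδ.trans hδ')
  have hAτε : 0 < residualConst m M * τ * ε := by positivity
  have htol := mul_le_mul_of_nonneg_right hκτ hε.le
  have hκε : 0 < κ * ε := (mul_pos hS.ry_pos hD).trans_le hryD
  rw [mul_div_cancel₀ _ hℓ.ne'] at hres
  refine ⟨t, ht.trans_eq (by field_simp), (hres.mono ?_ ?_).isGameStationary⟩ <;> linarith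

lemma le_half_of_sq_le_add_mul {η r : ℝ} (hε : 0 < ε) (hη : 0 ≤ η) (hκ : 0 ≤ κ)
    (hκη : κ + 3 * η ≤ 1 / 4) (h : r ^ 2 ≤ (η + κ) * ε ^ 2 + 3 * η * ε * r) : r ≤ ε / 2 := by
  by_contra! hr
  have hη_le := mul_le_mul_of_nonneg_right (by linarith : 3 * η ≤ 1 / 4) hε.le
  have hpos : 0 < (r - ε / 2) * (r + ε / 2 - 3 * η * ε) := mul_pos (by linarith) (by linarith)
  have hη_sq : 0 ≤ η * ε ^ 2 := by positivity
  linarith [mul_le_mul_of_nonneg_right hκη (sq_nonneg ε)]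

lemma IsNCCProblem.isOptStationary_of_hasGameResiduals {η : ℝ} {x : RVec n} {y : RVec d}
    (hP : IsNCCProblem X Y f ℓ) (hε : 0 < ε) (hη : 0 ≤ η) (hκ : 0 ≤ κ)
    (hκη : κ + 3 * η ≤ 1 / 4)
    (h : HasGameResiduals X Y f (3 * η * ε) ((η + κ) * (ε ^ 2 / (ℓ * Metric.diam Y))) x y) :
    IsOptStationary X Y f ℓ ε x := by
  have hℓ := hP.smooth.pos
  have hD := hP.diam_pos
  obtain ⟨v, hv, -⟩ := h.1
  obtain ⟨p, hp, hp_le⟩ := hP.exists_isProx_of_hasGameResiduals h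
  have hsq : (ℓ * ‖p - x‖) ^ 2 ≤ (η + κ) * ε ^ 2 + 3 * η * ε * (ℓ * ‖p - x‖) :=
    calc (ℓ * ‖p - x‖) ^ 2 = ℓ * (ℓ * ‖p - x‖ ^ 2) := by ring
      _ ≤ ℓ * (3 * η * ε * ‖p - x‖
            + (η + κ) * (ε ^ 2 / (ℓ * Metric.diam Y)) * Metric.diam Y) := by gcongr
      _ = (η + κ) * ε ^ 2 + 3 * η * ε * (ℓ * ‖p - x‖) := by field_simp; ring
  refine ⟨hv.1, p, hp, ?_⟩
  rw [le_div_iff₀ (by positivity)]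
  linarith [le_half_of_sq_le_add_mul hε hη hκ hκη hsq]

theorem IsPerturbedSmoothedGDA.exists_isOptStationary
    (hG : IsPerturbedSmoothedGDA X Y f rx ry c α β x y z) (hP : IsNCCProblem X Y f ℓ)
    (hS : StepSizeCondition m M ℓ rx ry c α β) (hryℓ : ry ≤ ℓ) (hm : 0 < m) (hτ : 0 < τ)
    (hκτ : κ + 3 * residualConst m M * τ ≤ 1 / 4) (hε : 0 < ε)
    (hθ : IsThetaWith m κ ry (ε ^ 2 / (ℓ * Metric.diam Y ^ 2))) :
    ∃ t : ℕ, (t : ℝ) ≤ 1 / (τ ^ 2 * min 1 (m ^ 2)) * (ℓ ^ 3 * Metric.diam Y ^ 2 *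
        initialGap X Y f rx ry (x 0) (y 0) (z 0) / ε ^ 4) ∧
      IsOptStationary X Y f ℓ ε (x (t + 1)) := by
  have hℓ := hP.smooth.pos
  have hD := hP.diam_pos
  have hA := residualConst_pos (M := M) hm
  have hβ := hS.mul_div_le_β hm hℓ hθ.1
  have hryD : ry * Metric.diam Y ≤ κ * (ε ^ 2 / (ℓ * Metric.diam Y)) := by
    refine (mul_le_mul_of_nonneg_right hθ.2 hD.le).trans_eq ?_
    field_simp
  have hδ : τ ^ 2 * min 1 (m ^ 2) * ε ^ 4 / (ℓ ^ 3 * Metric.diam Y ^ 2)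
      ≤ ℓ * (β * (τ * ε / ℓ) ^ 2) :=
    calc τ ^ 2 * min 1 (m ^ 2) * ε ^ 4 / (ℓ ^ 3 * Metric.diam Y ^ 2)
        ≤ τ ^ 2 * m ^ 2 * ε ^ 4 / (ℓ ^ 3 * Metric.diam Y ^ 2) := by
          gcongr
          exact min_le_right _ _
      _ = ℓ * (m * (m * (ε ^ 2 / (ℓ * Metric.diam Y ^ 2)) / ℓ) * (τ * ε / ℓ) ^ 2) := by field_simp
      _ ≤ ℓ * (β * (τ * ε / ℓ) ^ 2) := by gcongr
  have hδ' : τ ^ 2 * min 1 (m ^ 2) * ε ^ 4 / (ℓ ^ 3 * Metric.diam Y ^ 2)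
      ≤ ℓ * (τ * ε ^ 2 / (ℓ ^ 2 * Metric.diam Y)) ^ 2 :=
    calc τ ^ 2 * min 1 (m ^ 2) * ε ^ 4 / (ℓ ^ 3 * Metric.diam Y ^ 2)
        ≤ τ ^ 2 * 1 * ε ^ 4 / (ℓ ^ 3 * Metric.diam Y ^ 2) := by
          gcongr
          exact min_le_left _ _
      _ = ℓ * (τ * ε ^ 2 / (ℓ ^ 2 * Metric.diam Y)) ^ 2 := by field_simp
  obtain ⟨t, ht, hres⟩ := hG.exists_hasGameResiduals hP hS hryℓ hm (by positivity) (by positivity)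
    (by positivity) hδ hδ'
  have hκ : 0 < κ := pos_of_mul_pos_left ((mul_pos hS.ry_pos hD).trans_le hryD) (by positivity)
  have hx_tol : 3 * residualConst m M * (ℓ * (τ * ε / ℓ))
      = 3 * (residualConst m M * τ) * ε := by field_simp
  have hy_tol : residualConst m M * (ℓ * (τ * ε ^ 2 / (ℓ ^ 2 * Metric.diam Y)))
      = residualConst m M * τ * (ε ^ 2 / (ℓ * Metric.diam Y)) := by field_simp
  refine ⟨t, ht.trans_eq (by field_simp), hP.isOptStationary_of_hasGameResiduals hε
    (by positivity) hκ.le (by rwa [← mul_assoc]) (hres.mono hx_tol.le ?_)⟩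
  linarith

lemma exists_pos_add_mul_le {a b A : ℝ} (hab : a < b) (hA : 0 < A) : ∃ t, 0 < t ∧ a + A * t ≤ b :=
  ⟨(b - a) / A, div_pos (sub_pos.2 hab) hA, by rw [mul_div_cancel₀ _ hA.ne']; linarith⟩

end Complexity

theorem mainTheorem1 (m M : ℝ) (hm : 0 < m) :
    -- game stationarity
    (∀ κ : ℝ, κ < 1 → ∃ C : ℝ, 0 < C ∧
      ∀ (n d : ℕ) (X : Set (RVec n)) (Y : Set (RVec d)) (f : RVec n → RVec d → ℝ)
        (ℓ ε rx ry c α β : ℝ) (x : ℕ → RVec n) (y : ℕ → RVec d) (z : ℕ → RVec n),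
        IsNCCProblem X Y f ℓ →
        0 < ε →
        StepSizeCondition m M ℓ rx ry c α β →
        ry ≤ ℓ →
        IsThetaWith m κ ry (ε / Metric.diam Y) →
        IsPerturbedSmoothedGDA X Y f rx ry c α β x y z →
        ∃ t : ℕ,
          (t : ℝ) ≤ C * (ℓ ^ 2 * Metric.diam Y * initialGap X Y f rx ry (x 0) (y 0) (z 0)
            / ε ^ 3) ∧
          IsGameStationary X Y f ε (x (t + 1)) (y (t + 1))) ∧
    -- optimization stationarity
    (∀ κ : ℝ, κ < 1 / 4 → ∃ C : ℝ, 0 < C ∧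
      ∀ (n d : ℕ) (X : Set (RVec n)) (Y : Set (RVec d)) (f : RVec n → RVec d → ℝ)
        (ℓ ε rx ry c α β : ℝ) (x : ℕ → RVec n) (y : ℕ → RVec d) (z : ℕ → RVec n),
        IsNCCProblem X Y f ℓ →
        0 < ε →
        StepSizeCondition m M ℓ rx ry c α β →
        ry ≤ ℓ →
        IsThetaWith m κ ry (ε ^ 2 / (ℓ * Metric.diam Y ^ 2)) →
        IsPerturbedSmoothedGDA X Y f rx ry c α β x y z →
        ∃ t : ℕ,
          (t : ℝ) ≤ C * (ℓ ^ 3 * Metric.diam Y ^ 2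
            * initialGap X Y f rx ry (x 0) (y 0) (z 0) / ε ^ 4) ∧
          IsOptStationary X Y f ℓ ε (x (t + 1))) := by
  have hA := residualConst_pos (M := M) hm
  refine ⟨fun κ hκ => ?_, fun κ hκ => ?_⟩
  · obtain ⟨τ, hτ, hκτ⟩ := exists_pos_add_mul_le hκ (by positivity : 0 < 3 * residualConst m M)
    exact ⟨1 / (τ ^ 2 * m ^ 2), by positivity,
      fun _ _ _ _ _ _ _ _ _ _ _ _ _ _ _ hP hε hS hryℓ hθ hG =>
        hG.exists_isGameStationary hP hS hryℓ hm hτ hκτ hε hθ⟩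
  · obtain ⟨τ, hτ, hκτ⟩ := exists_pos_add_mul_le hκ (by positivity : 0 < 3 * residualConst m M)
    exact ⟨1 / (τ ^ 2 * min 1 (m ^ 2)), by positivity,
      fun _ _ _ _ _ _ _ _ _ _ _ _ _ _ _ hP hε hS hryℓ hθ hG =>
        hG.exists_isOptStationary hP hS hryℓ hm hτ hκτ hε hθ⟩
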